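/- Let $n\ge 1$ and let $Q^n=\{[X]\in\mathbb{CP}^{n+1}:\sum_i X_i^2=0\}\cong SO(n+2)/(SO(n)\times SO(2))$ be the complex hyperquadric, with base point $o=[0:\cdots:0:1:\sqrt{-1}]$. Identify $T_oQ^n$ with $$\mathfrak p=\left\{P_X=\begin{pmatrix}0&-X^T\\X&0\end{pmatrix}:X\in M_{2\times n}(\mathbb R)\right\}\subset\mathfrak{so}(n+2)$$ by sending $P_X$ to the velocity of $t\mapsto \exp(tP_X)\cdot o$ at $t=0$. For every $c>0$ there is an $SO(n+2)$-invariant Riemannian metric $g$ on $Q^n$ with $g_o(P_X,P_Y)=-c\,\mathrm{tr}(P_XP_Y)$ (the Hermitian symmetric metric, normalized by $c$), and every such $g$ has the following properties. Let $R$ be the Riemann curvature tensor of $g$, with $R(u,v)w=\nabla_u\nabla_vw-\nabla_v\nabla_uw-\nabla_{[u,v]}w$, and extend $R$ and $g$ complex multilinearly to the complexified tangent spaces. 1. $Q^n$ has nonnegative bisectional curvature: $g(R(U,\bar U)V,\bar V)$ is real and $\ge 0$ for all $x\in Q^n$ and $U,V\in T^{1,0}_xQ^n$. 2. For every $x\in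 Q^n$ and every nonzero $U\in T^{1,0}_xQ^n$, the operator $R(U,\bar U)$ maps $T^{1,0}_xQ^n$ to itself and is diagonalizable there with real eigenvalues $\lambda_1\le\cdots\le\lambda_n$ (counted with multiplicity); all of them are nonnegative and at most one of them is zero. 3. If $n\ge 2$, then $Q^n$ has $2$-positive bisectional curvature: $\lambda_1+\lambda_2>0$ for every $x\in Q^n$ and every nonzero $U\in T^{1,0}_xQ^n$, where $\lambda_1\le\lambda_2$ are the two smallest eigenvalues of $R(U,\bar U)$ on $T^{1,0}_xQ^n$. -/

import Mathlib

set_option maxSynthPendingDepth 3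

open scoped Manifold ContDiff Matrix TensorProduct LinearAlgebra.Projectivization

/-! ## Riemannian curvature of a manifold, computed in charts -/

namespace RiemannianChart

noncomputable section

variable {E : Type*} [NormedAddCommGroup E] [NormedSpace ℝ E]

/-- The Christoffel tensor `Γ_z(u, v)` of the Levi-Civita connection of a metric `G` on (an open
subset of) the vector space `E`: the solution of
`2 G_z(Γ_z(u,v), w) = D_u G(v,w) + D_v G(u,w) - D_w G(u,v)`. -/
def christoffel (G : E → E →L[ℝ] E →L[ℝ] ℝ) (z : E) : E →L[ℝ] E →L[ℝ] E :=
  let D : E →L[ℝ] E →L[ℝ] E →L[ℝ] ℝ := fderiv ℝ G z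
  let K : E →L[ℝ] E →L[ℝ] E →L[ℝ] ℝ :=
    (1 / 2 : ℝ) • (D + D.flip -
      ((ContinuousLinearMap.flipₗᵢ ℝ E E ℝ).toContinuousLinearEquiv :
        (E →L[ℝ] E →L[ℝ] ℝ) →L[ℝ] (E →L[ℝ] E →L[ℝ] ℝ)).comp D.flip)
  (ContinuousLinearMap.compL ℝ E (E →L[ℝ] ℝ) E (ContinuousLinearMap.inverse (G z))).comp K

/-- The Riemann tensor `R(u,v)w = ∇_u ∇_v w - ∇_v ∇_u w` (for constant vector fields) of a metric
`G` on (an open subset of) the vector space `E`. -/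
def curvature (G : E → E →L[ℝ] E →L[ℝ] ℝ) (z : E) : E →L[ℝ] E →L[ℝ] E →L[ℝ] E :=
  let dΓ : E →L[ℝ] E →L[ℝ] E →L[ℝ] E := fderiv ℝ (christoffel G) z
  let C : E →L[ℝ] E →L[ℝ] E →L[ℝ] E :=
    (ContinuousLinearMap.compL ℝ E E E).bilinearComp (christoffel G z) (christoffel G z)
  dΓ - dΓ.flip + C - C.flip

/-- The Christoffel tensor, evaluated. -/
theorem christoffel_apply (G : E → E →L[ℝ] E →L[ℝ] ℝ) (z u v : E) :
    ∃ k : E →L[ℝ] ℝ, christoffel G z u v = ContinuousLinearMap.inverse (G z) k ∧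
      ∀ w, 2 * k w = fderiv ℝ G z u v w + fderiv ℝ G z v u w - fderiv ℝ G z w u v := by
  refine ⟨_, rfl, fun w => ?_⟩
  simp

/-- The curvature tensor, evaluated. -/
theorem curvature_apply (G : E → E →L[ℝ] E →L[ℝ] ℝ) (z u v w : E) :
    curvature G z u v w =
      fderiv ℝ (christoffel G) z u v w - fderiv ℝ (christoffel G) z v u w
        + christoffel G z u (christoffel G z v w) - christoffel G z v (christoffel G z u w) := by
  simp [curvature]

variable {M : Type*} [TopologicalSpace M] [ChartedSpace E M]

/-- A (not necessarily smooth or positive) family of bilinear forms on the tangent spaces of `M`. -/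
abbrev MetricField (E : Type*) [NormedAddCommGroup E] [NormedSpace ℝ E]
    (M : Type*) [TopologicalSpace M] [ChartedSpace E M] :=
  ∀ x : M, TangentSpace 𝓘(ℝ, E) x →L[ℝ] TangentSpace 𝓘(ℝ, E) x →L[ℝ] ℝ

/-- The coordinate expression of `g` in the preferred chart at `x₀`. -/
def metricInChart (g : MetricField E M) (x₀ : M) (z : E) : E →L[ℝ] E →L[ℝ] ℝ :=
  let x : M := (chartAt E x₀).symm z
  let b : E →L[ℝ] E →L[ℝ] ℝ := g x
  let d : E →L[ℝ] E := mfderiv 𝓘(ℝ, E) 𝓘(ℝ, E) (chartAt E x₀).symm z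
  b.bilinearComp d d

/-- `g` is a smooth Riemannian metric. -/
structure IsRiemannianMetric (g : MetricField E M) : Prop where
  symm : ∀ (x : M) (u v : TangentSpace 𝓘(ℝ, E) x), g x u v = g x v u
  pos : ∀ (x : M) (u : TangentSpace 𝓘(ℝ, E) x), u ≠ 0 → 0 < g x u u
  smooth : ∀ x₀ : M, ContDiffOn ℝ ∞ (metricInChart g x₀) (chartAt E x₀).target

/-- The Riemann curvature tensor `R(u,v)w` of `g` at `x`, computed in the preferred chart at `x`
(in which the tangent space at `x` is the model space). -/
def curvatureAt (g : MetricField E M) (x : M) :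
    TangentSpace 𝓘(ℝ, E) x →ₗ[ℝ] TangentSpace 𝓘(ℝ, E) x →ₗ[ℝ]
      Module.End ℝ (TangentSpace 𝓘(ℝ, E) x) :=
  let R : E →L[ℝ] E →L[ℝ] E →L[ℝ] E := curvature (metricInChart g x) (chartAt E x x)
  let R' : E →ₗ[ℝ] E →ₗ[ℝ] Module.End ℝ E :=
    LinearMap.mk₂ ℝ (fun u v => (R u v : E →ₗ[ℝ] E))
      (fun u u' v => by ext w; simp) (fun c u v => by ext w; simp)
      (fun u v v' => by ext w; simp) (fun c u v => by ext w; simp)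
  R'

/-- The velocity at time `0` of a curve `γ` in `M` with `γ 0 = x`. -/
def velocityAt (γ : ℝ → M) {x : M} (h : γ 0 = x) : TangentSpace 𝓘(ℝ, E) x :=
  h ▸ mfderiv 𝓘(ℝ, ℝ) 𝓘(ℝ, E) γ 0 (1 : ℝ)

end

end RiemannianChart

/-! ## Complexified tangent vectors and bisectional curvature -/

namespace Bisectional

noncomputable section

variable {V : Type*} [AddCommGroup V] [Module ℝ V]

/-- Complex conjugation on the complexification of a real vector space. -/
def conj : ℂ ⊗[ℝ] V →ₗ[ℝ] ℂ ⊗[ℝ] V := LinearMap.rTensor V Complex.conjAe.toLinearMap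

/-- The holomorphic part `V^{1,0}` of the complexification: the `√-1`-eigenspace of `J`. -/
def holomorphicPart (J : Module.End ℝ V) : Submodule ℂ (ℂ ⊗[ℝ] V) :=
  Module.End.eigenspace (J.baseChange ℂ) Complex.I

/-- The complex trilinear extension of a curvature tensor. -/
def complexCurvature (R : V →ₗ[ℝ] V →ₗ[ℝ] Module.End ℝ V) :
    ℂ ⊗[ℝ] V →ₗ[ℂ] ℂ ⊗[ℝ] V →ₗ[ℂ] Module.End ℂ (ℂ ⊗[ℝ] V) :=
  LinearMap.liftBaseChange ℂ
    (((LinearMap.liftBaseChangeEquiv (R := ℝ) (M := V) (N := Module.End ℂ (ℂ ⊗[ℝ] V))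
        ℂ).toLinearMap.restrictScalars ℝ) ∘ₗ
      (R.compr₂ (LinearMap.baseChangeHom ℝ ℂ V V)))

theorem complexCurvature_tmul (R : V →ₗ[ℝ] V →ₗ[ℝ] Module.End ℝ V) (a b c : ℂ) (x y z : V) :
    complexCurvature R (a ⊗ₜ x) (b ⊗ₜ y) (c ⊗ₜ z) = (a * b * c) ⊗ₜ[ℝ] (R x y z) := by
  simp [complexCurvature, TensorProduct.smul_tmul', mul_assoc]

/-- The operator `R(U, Ū)` on the complexified tangent space. -/
def curvatureOperator (R : V →ₗ[ℝ] V →ₗ[ℝ] Module.End ℝ V) (U : ℂ ⊗[ℝ] V) :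
    Module.End ℂ (ℂ ⊗[ℝ] V) :=
  complexCurvature R U (conj U)

/-- The bisectional curvature `R(U, Ū, W, W̄) = g(R(U, Ū)W, W̄)`, where the metric is extended
complex bilinearly. -/
def bisectionalCurvature (g : LinearMap.BilinForm ℝ V) (R : V →ₗ[ℝ] V →ₗ[ℝ] Module.End ℝ V)
    (U W : ℂ ⊗[ℝ] V) : ℂ :=
  (g.baseChange ℂ) (curvatureOperator R U W) (conj W)

/-- `T` maps the subspace `S` to itself, is diagonalizable there with real eigenvalues, and
`ev 0 ≤ ev 1 ≤ ⋯ ≤ ev (n - 1)` is the list of its eigenvalues on `S`, with multiplicity. -/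
def HasOrderedEigenvalues {W : Type*} [AddCommGroup W] [Module ℂ W] (T : Module.End ℂ W)
    (S : Submodule ℂ W) {n : ℕ} (ev : Fin n → ℝ) : Prop :=
  Monotone ev ∧ ∃ b : Module.Basis (Fin n) ℂ S, ∀ i, T (b i : W) = (ev i : ℂ) • (b i : W)

open RiemannianChart

variable {E : Type*} [NormedAddCommGroup E] [NormedSpace ℝ E]
  {M : Type*} [TopologicalSpace M] [ChartedSpace E M]

/-- The metric at a point, as a bilinear form. -/
def metricForm (g : MetricField E M) (x : M) :
    LinearMap.BilinForm ℝ (TangentSpace 𝓘(ℝ, E) x) :=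
  LinearMap.mk₂ ℝ (fun u v => g x u v) (fun u u' v => by simp) (fun c u v => by simp)
    (fun u v v' => by simp) (fun c u v => by simp)

/-- Nonnegative bisectional curvature: `R(U, Ū, W, W̄)` is a nonnegative real number for all
`U, W ∈ T^{1,0}_x M` and all `x`. -/
def HasNonnegBisectionalCurvature (g : MetricField E M)
    (J : ∀ x : M, Module.End ℝ (TangentSpace 𝓘(ℝ, E) x)) : Prop :=
  ∀ x : M, ∀ U ∈ holomorphicPart (J x), ∀ W ∈ holomorphicPart (J x),
    0 ≤ (bisectionalCurvature (metricForm g x) (curvatureAt g x) U W).re ∧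
      (bisectionalCurvature (metricForm g x) (curvatureAt g x) U W).im = 0

/-- `2`-positive bisectional curvature, for a manifold of complex dimension `n ≥ 2`: for all `x`
and all nonzero `U ∈ T^{1,0}_x M` the sum of the two smallest eigenvalues of the operator
`R(U, Ū)` on `T^{1,0}_x M` is positive. -/
def HasTwoPositiveBisectionalCurvature (g : MetricField E M)
    (J : ∀ x : M, Module.End ℝ (TangentSpace 𝓘(ℝ, E) x)) (n : ℕ) (hn : 2 ≤ n) : Prop :=
  ∀ x : M, ∀ U ∈ holomorphicPart (J x), U ≠ 0 → ∃ ev : Fin n → ℝ,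
    HasOrderedEigenvalues (curvatureOperator (curvatureAt g x) U) (holomorphicPart (J x)) ev ∧
      0 < ev ⟨0, by omega⟩ + ev ⟨1, by omega⟩

end

end Bisectional

/-! ## The complex hyperquadric -/

/-- The complex hyperquadric `{[X] : ∑ X_i ^ 2 = 0}` in `ℂP^{n+1}`. The `n + 2` homogeneous
coordinates are indexed by `Fin n ⊕ Fin 2`. -/
def Hyperquadric (n : ℕ) : Type :=
  {p : ℙ ℂ (Fin n ⊕ Fin 2 → ℂ) // p.rep ⬝ᵥ p.rep = 0}

namespace Hyperquadric

noncomputable section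

variable {n : ℕ}

theorem rep_mk_dotProduct {ι : Type*} [Fintype ι] (v : ι → ℂ) (hv : v ≠ 0) (h : v ⬝ᵥ v = 0) :
    (Projectivization.mk ℂ v hv).rep ⬝ᵥ (Projectivization.mk ℂ v hv).rep = 0 := by
  obtain ⟨a, ha⟩ := Projectivization.exists_smul_eq_mk_rep ℂ v hv
  rw [← ha, Units.smul_def, smul_dotProduct, dotProduct_smul, h]
  simp

/-- The point `[v]` of the hyperquadric. -/
def mk (v : Fin n ⊕ Fin 2 → ℂ) (hv : v ≠ 0) (h : v ⬝ᵥ v = 0) : Hyperquadric n :=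
  ⟨Projectivization.mk ℂ v hv, rep_mk_dotProduct v hv h⟩

/-- The action of a real matrix on `ℂ^{n+2}`. -/
def act (A : Matrix (Fin n ⊕ Fin 2) (Fin n ⊕ Fin 2) ℝ) (v : Fin n ⊕ Fin 2 → ℂ) :
    Fin n ⊕ Fin 2 → ℂ :=
  A.map Complex.ofReal *ᵥ v

/-- The orthogonal group `O(n+2)`. -/
abbrev Orth (n : ℕ) := Matrix.orthogonalGroup (Fin n ⊕ Fin 2) ℝ

/-- The special orthogonal group `SO(n+2)`. -/
abbrev SOrth (n : ℕ) := Matrix.specialOrthogonalGroup (Fin n ⊕ Fin 2) ℝ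

theorem act_mul (A B : Matrix (Fin n ⊕ Fin 2) (Fin n ⊕ Fin 2) ℝ) (v : Fin n ⊕ Fin 2 → ℂ) :
    act A (act B v) = act (A * B) v := by
  have : (A * B).map Complex.ofReal = A.map Complex.ofReal * B.map Complex.ofReal :=
    Matrix.map_mul (f := Complex.ofRealHom)
  simp [act, this, Matrix.mulVec_mulVec]

theorem act_one (v : Fin n ⊕ Fin 2 → ℂ) : act 1 v = v := by
  have : (1 : Matrix (Fin n ⊕ Fin 2) (Fin n ⊕ Fin 2) ℝ).map Complex.ofReal = 1 :=
    Matrix.map_one _ Complex.ofReal_zero Complex.ofReal_one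
  simp [act, this]

theorem act_smul (A : Matrix (Fin n ⊕ Fin 2) (Fin n ⊕ Fin 2) ℝ) (c : ℂ)
    (v : Fin n ⊕ Fin 2 → ℂ) : act A (c • v) = c • act A v := by
  simp [act, Matrix.mulVec_smul]

theorem transpose_mul_self (A : Orth n) : A.1ᵀ * A.1 = 1 := by
  exact (Matrix.mem_orthogonalGroup_iff' _ _).1 A.2

theorem mul_transpose_self (A : Orth n) : A.1 * A.1ᵀ = 1 := by
  exact (Matrix.mem_orthogonalGroup_iff _ _).1 A.2

theorem act_transpose_act (A : Orth n) (v : Fin n ⊕ Fin 2 → ℂ) :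
    act A.1ᵀ (act A v) = v := by
  rw [act_mul, transpose_mul_self, act_one]

theorem act_act_transpose (A : Orth n) (v : Fin n ⊕ Fin 2 → ℂ) :
    act A (act A.1ᵀ v) = v := by
  rw [act_mul, mul_transpose_self, act_one]

theorem act_dotProduct_act (A : Orth n) (v w : Fin n ⊕ Fin 2 → ℂ) :
    act A v ⬝ᵥ act A w = v ⬝ᵥ w := by
  have h : act A v ⬝ᵥ act A w = v ⬝ᵥ act A.1ᵀ (act A w) := by
    simp only [act, Matrix.transpose_map]
    rw [Matrix.mulVec_transpose, dotProduct_comm v, ← Matrix.dotProduct_mulVec, dotProduct_comm]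
  rw [h, act_transpose_act]

theorem act_ne_zero (A : Orth n) {v : Fin n ⊕ Fin 2 → ℂ} (hv : v ≠ 0) :
    act A.1 v ≠ 0 := by
  intro h
  apply hv
  rw [← act_transpose_act A v, h]
  simp [act]

/-- The action of `O(n+2)` on the hyperquadric, `A · [v] = [A v]`. -/
def rotate (A : Orth n) (x : Hyperquadric n) : Hyperquadric n :=
  mk (act A x.1.rep) (act_ne_zero A x.1.rep_nonzero) (by rw [act_dotProduct_act]; exact x.2)

theorem mk_eq_mk {v w : Fin n ⊕ Fin 2 → ℂ} {hv : v ≠ 0} {hw : w ≠ 0} {h : v ⬝ᵥ v = 0}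
    {h' : w ⬝ᵥ w = 0} (c : ℂ) (hc : c • w = v) : mk v hv h = mk w hw h' :=
  Subtype.ext ((Projectivization.mk_eq_mk_iff' ℂ v w hv hw).2 ⟨c, hc⟩)

theorem rotate_mk (A : Orth n) (v : Fin n ⊕ Fin 2 → ℂ) (hv : v ≠ 0) (h : v ⬝ᵥ v = 0) :
    rotate A (mk v hv h) =
      mk (act A v) (act_ne_zero A hv) (by rw [act_dotProduct_act]; exact h) := by
  obtain ⟨a, ha⟩ := Projectivization.exists_smul_eq_mk_rep ℂ v hv
  refine mk_eq_mk (a : ℂ) ?_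
  rw [← act_smul]
  exact congrArg _ ha

theorem mk_rep (x : Hyperquadric n) : mk x.1.rep x.1.rep_nonzero x.2 = x :=
  Subtype.ext (Projectivization.mk_rep _)

theorem rotate_one (x : Hyperquadric n) : rotate 1 x = x := by
  conv_rhs => rw [← mk_rep x]
  exact mk_eq_mk 1 (by rw [one_smul]; exact (act_one _).symm)

/-- The inclusion of `SO(n+2)` in `O(n+2)`. -/
def toOrth (A : SOrth n) : Orth n := ⟨A.1, A.2.1⟩

/-! ### Holomorphic charts -/

/-- The parametrization of the affine part of the cone over the hyperquadric around
`(0, …, 0, 1, √-1)`. -/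
def param (z : Fin n → ℂ) : Fin n ⊕ Fin 2 → ℂ :=
  Sum.elim z ![1 - (z ⬝ᵥ z) / 4, Complex.I * (1 + (z ⬝ᵥ z) / 4)]

/-- The denominator `X_{n+1} - √-1 X_{n+2}` of the affine coordinates. -/
def den (v : Fin n ⊕ Fin 2 → ℂ) : ℂ := v (Sum.inr 0) - Complex.I * v (Sum.inr 1)

/-- The affine coordinates, inverse to `param`. -/
def coord (v : Fin n ⊕ Fin 2 → ℂ) : Fin n → ℂ := fun i => 2 * v (Sum.inl i) / den v

theorem den_param (z : Fin n → ℂ) : den (param z) = 2 := by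
  have := Complex.I_mul_I
  simp only [den, param, Sum.elim_inr, Matrix.cons_val_zero, Matrix.cons_val_one]
  linear_combination -(1 + (z ⬝ᵥ z) / 4) * this

theorem param_ne_zero (z : Fin n → ℂ) : param z ≠ 0 := by
  intro h
  have := den_param z
  rw [h] at this
  simp [den] at this

theorem dotProduct_self_eq (v : Fin n ⊕ Fin 2 → ℂ) :
    v ⬝ᵥ v = (fun i => v (Sum.inl i)) ⬝ᵥ (fun i => v (Sum.inl i))
      + v (Sum.inr 0) ^ 2 + v (Sum.inr 1) ^ 2 := by
  simp [dotProduct, Fintype.sum_sum_type, Fin.sum_univ_two]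
  ring

theorem param_null (z : Fin n → ℂ) : param z ⬝ᵥ param z = 0 := by
  rw [dotProduct_self_eq]
  simp only [param, Sum.elim_inr, Sum.elim_inl, Matrix.cons_val_zero, Matrix.cons_val_one]
  have : Complex.I ^ 2 = -1 := Complex.I_sq
  linear_combination (1 + (z ⬝ᵥ z) / 4) ^ 2 * this

theorem coord_param (z : Fin n → ℂ) : coord (param z) = z := by
  funext i
  simp only [coord, den_param]
  simp [param]

theorem den_smul (c : ℂ) (v : Fin n ⊕ Fin 2 → ℂ) : den (c • v) = c * den v := by
  simp [den]; ring

theorem coord_smul {c : ℂ} (hc : c ≠ 0) (v : Fin n ⊕ Fin 2 → ℂ) : coord (c • v) = coord v := by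
  funext i
  simp only [coord, den_smul, Pi.smul_apply, smul_eq_mul]
  rw [mul_left_comm, mul_div_mul_left _ _ hc]

theorem smul_param_coord {v : Fin n ⊕ Fin 2 → ℂ} (h : v ⬝ᵥ v = 0) (hd : den v ≠ 0) :
    (den v / 2) • param (coord v) = v := by
  rw [dotProduct_self_eq] at h
  have hI : Complex.I * Complex.I = -1 := Complex.I_mul_I
  set q := (fun i => v (Sum.inl i)) ⬝ᵥ (fun i => v (Sum.inl i)) with hq
  have hz : coord v ⬝ᵥ coord v = 4 * q / den v ^ 2 := by
    rw [hq]
    simp only [dotProduct, coord, Finset.mul_sum, Finset.sum_div]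
    refine Finset.sum_congr rfl fun i _ => ?_
    field_simp
    ring
  have hprod : den v * (v (Sum.inr 0) + Complex.I * v (Sum.inr 1)) = -q := by
    simp only [den]
    linear_combination h - v (Sum.inr 1) ^ 2 * hI
  have hqd : den v / 2 * ((4 * q / den v ^ 2) / 4)
      = -(v (Sum.inr 0) + Complex.I * v (Sum.inr 1)) / 2 := by
    field_simp
    linear_combination hprod
  funext k
  rcases k with i | k
  · simp only [param, coord, Pi.smul_apply, Sum.elim_inl, smul_eq_mul]
    field_simp
  · fin_cases k
    · simp only [param, Pi.smul_apply, Sum.elim_inr, smul_eq_mul, hz, Fin.zero_eta,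
        Matrix.cons_val_zero]
      rw [mul_sub, hqd]
      simp only [den]; ring
    · simp only [param, Pi.smul_apply, Sum.elim_inr, smul_eq_mul, hz, Fin.mk_one,
        Matrix.cons_val_one, Matrix.cons_val_zero]
      rw [mul_left_comm, mul_add, hqd]
      simp only [den]
      linear_combination -v (Sum.inr 1) * hI

/-- The topology of the hyperquadric, as a subspace of projective space with its quotient
topology. -/
instance : TopologicalSpace (Hyperquadric n) :=
  TopologicalSpace.induced Subtype.val
    (TopologicalSpace.coinduced
      (Projectivization.mk' ℂ : {v : Fin n ⊕ Fin 2 → ℂ // v ≠ 0} → ℙ ℂ (Fin n ⊕ Fin 2 → ℂ))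
      inferInstance)

theorem continuous_act (A : Matrix (Fin n ⊕ Fin 2) (Fin n ⊕ Fin 2) ℝ) : Continuous (act A) := by
  unfold act
  exact Continuous.matrix_mulVec continuous_const continuous_id

theorem continuous_param : Continuous (param : (Fin n → ℂ) → _) := by
  refine continuous_pi fun k => ?_
  rcases k with i | k
  · simp only [param, Sum.elim_inl]; fun_prop
  · fin_cases k <;> simp only [param, Sum.elim_inr, dotProduct, Fin.zero_eta, Fin.mk_one,
      Matrix.cons_val_zero, Matrix.cons_val_one] <;> fun_prop

theorem continuous_den : Continuous (den : (Fin n ⊕ Fin 2 → ℂ) → ℂ) := by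
  unfold den; fun_prop

theorem rep_eq {v : Fin n ⊕ Fin 2 → ℂ} (hv : v ≠ 0) :
    ∃ c : ℂ, c ≠ 0 ∧ (Projectivization.mk ℂ v hv).rep = c • v := by
  obtain ⟨a, ha⟩ := Projectivization.exists_smul_eq_mk_rep ℂ v hv
  exact ⟨a, a.ne_zero, ha.symm⟩

theorem chart_open_aux (A : Matrix (Fin n ⊕ Fin 2) (Fin n ⊕ Fin 2) ℝ) :
    IsOpen {x : Hyperquadric n | den (act A x.1.rep) ≠ 0} ∧
      ContinuousOn (fun x : Hyperquadric n => coord (act A x.1.rep))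
        {x : Hyperquadric n | den (act A x.1.rep) ≠ 0} := by
  let tP : TopologicalSpace (ℙ ℂ (Fin n ⊕ Fin 2 → ℂ)) := TopologicalSpace.coinduced
      (Projectivization.mk' ℂ : {v : Fin n ⊕ Fin 2 → ℂ // v ≠ 0} → ℙ ℂ (Fin n ⊕ Fin 2 → ℂ))
      inferInstance
  have hq : Topology.IsQuotientMap
      (Projectivization.mk' ℂ : {v : Fin n ⊕ Fin 2 → ℂ // v ≠ 0} → ℙ ℂ (Fin n ⊕ Fin 2 → ℂ)) :=
    ⟨⟨rfl⟩, Quotient.mk''_surjective⟩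
  have hval : Continuous (Subtype.val : Hyperquadric n → ℙ ℂ (Fin n ⊕ Fin 2 → ℂ)) :=
    continuous_induced_dom
  have hden : ∀ v : {v : Fin n ⊕ Fin 2 → ℂ // v ≠ 0},
      den (act A (Projectivization.mk' ℂ v).rep) ≠ 0 ↔ den (act A v.1) ≠ 0 := by
    intro v
    obtain ⟨c, hc, h⟩ := rep_eq v.2
    rw [Projectivization.mk'_eq_mk, h, act_smul, den_smul]
    simp [hc]
  have hcoord : ∀ v : {v : Fin n ⊕ Fin 2 → ℂ // v ≠ 0},
      coord (act A (Projectivization.mk' ℂ v).rep) = coord (act A v.1) := by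
    intro v
    obtain ⟨c, hc, h⟩ := rep_eq v.2
    rw [Projectivization.mk'_eq_mk, h, act_smul, coord_smul hc]
  have hopen : IsOpen {p : ℙ ℂ (Fin n ⊕ Fin 2 → ℂ) | den (act A p.rep) ≠ 0} := by
    rw [← hq.isOpen_preimage]
    simp only [Set.preimage_ofPred_eq, hden]
    exact isOpen_ne_fun
      (continuous_den.comp ((continuous_act A).comp continuous_subtype_val)) continuous_const
  have hcont : ContinuousOn (fun p : ℙ ℂ (Fin n ⊕ Fin 2 → ℂ) => coord (act A p.rep))
      {p : ℙ ℂ (Fin n ⊕ Fin 2 → ℂ) | den (act A p.rep) ≠ 0} := by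
    rw [hq.continuousOn_isOpen_iff hopen]
    simp only [Set.preimage_ofPred_eq, hden]
    have : ((fun p : ℙ ℂ (Fin n ⊕ Fin 2 → ℂ) => coord (act A p.rep)) ∘ Projectivization.mk' ℂ)
        = fun v => coord (act A v.1) := funext hcoord
    rw [this]
    refine continuousOn_pi.2 fun i => ?_
    refine ContinuousOn.div ?_ ?_ fun v hv => hv
    · exact (continuous_const.mul ((continuous_apply _).comp
        ((continuous_act A).comp continuous_subtype_val))).continuousOn
    · exact (continuous_den.comp ((continuous_act A).comp continuous_subtype_val)).continuousOn
  exact ⟨hopen.preimage hval, hcont.comp hval.continuousOn fun x hx => hx⟩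

/-- The point of the hyperquadric with affine coordinates `z` in the chart rotated by `A`. -/
def point (A : Orth n) (z : Fin n → ℂ) : Hyperquadric n :=
  mk (act A (param z)) (act_ne_zero A (param_ne_zero z))
    (by rw [act_dotProduct_act]; exact param_null z)

theorem continuous_point (A : Orth n) : Continuous (point A) := by
  refine continuous_induced_rng.2 ?_
  have h : Continuous fun z : Fin n → ℂ =>
      (⟨act A (param z), act_ne_zero A (param_ne_zero z)⟩ : {v : Fin n ⊕ Fin 2 → ℂ // v ≠ 0}) :=
    ((continuous_act _).comp continuous_param).subtype_mk _
  let tP : TopologicalSpace (ℙ ℂ (Fin n ⊕ Fin 2 → ℂ)) := TopologicalSpace.coinduced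
      (Projectivization.mk' ℂ : {v : Fin n ⊕ Fin 2 → ℂ // v ≠ 0} → ℙ ℂ (Fin n ⊕ Fin 2 → ℂ))
      inferInstance
  exact continuous_coinduced_rng.comp h

theorem rep_point (A : Orth n) (z : Fin n → ℂ) :
    ∃ c : ℂ, c ≠ 0 ∧ (point A z).1.rep = c • act A (param z) :=
  rep_eq _

/-- The affine chart of the hyperquadric, rotated by `A ∈ O(n+2)`; its inverse is
`z ↦ [A (z, 1 - z·z/4, √-1 (1 + z·z/4))]`. -/
def chart (A : Orth n) : OpenPartialHomeomorph (Hyperquadric n) (Fin n → ℂ) where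
  toFun x := coord (act A.1ᵀ x.1.rep)
  invFun := point A
  source := {x | den (act A.1ᵀ x.1.rep) ≠ 0}
  target := Set.univ
  map_source' _ _ := Set.mem_univ _
  map_target' z _ := by
    obtain ⟨c, hc, h⟩ := rep_point A z
    simp [h, act_smul, act_transpose_act, den_smul, den_param, hc]
  left_inv' x hx := by
    conv_rhs => rw [← mk_rep x]
    symm
    refine mk_eq_mk (den (act A.1ᵀ x.1.rep) / 2) ?_
    rw [← act_smul, smul_param_coord _ hx, act_act_transpose]
    have := act_dotProduct_act A (act A.1ᵀ x.1.rep)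
      (act A.1ᵀ x.1.rep)
    rw [← this, act_act_transpose]
    exact x.2
  right_inv' z _ := by
    obtain ⟨c, hc, h⟩ := rep_point A z
    rw [h, act_smul, act_transpose_act, coord_smul hc, coord_param]
  open_source := (chart_open_aux _).1
  open_target := isOpen_univ
  continuousOn_toFun := (chart_open_aux _).2
  continuousOn_invFun := (continuous_point A).continuousOn

/-- The base point `[0 : ⋯ : 0 : 1 : √-1]`, whose stabilizer in `SO(n+2)` is `SO(n) × SO(2)`. -/
def base (n : ℕ) : Hyperquadric n := point 1 0

theorem exists_orth (x : Hyperquadric n) : ∃ A : Orth n, point A 0 = x := by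
  obtain ⟨v, hv, hx⟩ : ∃ v, v = x.1.rep ∧ v ≠ 0 := ⟨_, rfl, x.1.rep_nonzero⟩
  have hnull : v ⬝ᵥ v = 0 := hv ▸ x.2
  let u : EuclideanSpace ℝ (Fin n ⊕ Fin 2) := WithLp.toLp 2 fun k => (v k).re
  let w : EuclideanSpace ℝ (Fin n ⊕ Fin 2) := WithLp.toLp 2 fun k => (v k).im
  have huu : inner ℝ u u = ∑ k, (v k).re * (v k).re := by
    rw [PiLp.inner_apply]; rfl
  have hww : inner ℝ w w = ∑ k, (v k).im * (v k).im := by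
    rw [PiLp.inner_apply]; rfl
  have huw : inner ℝ u w = ∑ k, (v k).re * (v k).im := by
    rw [PiLp.inner_apply]; exact Finset.sum_congr rfl fun k _ => mul_comm _ _
  have hre : inner ℝ u u = inner ℝ w w := by
    have := congrArg Complex.re hnull
    simp only [dotProduct, Complex.re_sum, Complex.mul_re, Finset.sum_sub_distrib,
      Complex.zero_re] at this
    rw [huu, hww]; linarith
  have him : inner ℝ u w = 0 := by
    have := congrArg Complex.im hnull
    simp only [dotProduct, Complex.im_sum, Complex.mul_im, Finset.sum_add_distrib,
      Complex.zero_im] at this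
    rw [huw]
    have h2 : ∑ k, (v k).im * (v k).re = ∑ k, (v k).re * (v k).im :=
      Finset.sum_congr rfl fun k _ => mul_comm _ _
    linarith
  have hu0 : u ≠ 0 := by
    intro h0
    apply hx
    have h1 : inner ℝ w w = 0 := by rw [← hre, h0]; simp
    have h2 : w = 0 := inner_self_eq_zero.1 h1
    funext k
    apply Complex.ext
    · simpa [u] using congrArg (fun y => y.ofLp k) h0
    · simpa [w] using congrArg (fun y => y.ofLp k) h2
  have hr : 0 < ‖u‖ := norm_pos_iff.2 hu0
  have hnw : ‖w‖ = ‖u‖ := by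
    rw [real_inner_self_eq_norm_sq, real_inner_self_eq_norm_sq] at hre
    exact ((sq_eq_sq₀ (norm_nonneg _) (norm_nonneg _)).1 hre).symm
  let f : Fin n ⊕ Fin 2 → EuclideanSpace ℝ (Fin n ⊕ Fin 2) :=
    Sum.elim (fun _ => 0) ![‖u‖⁻¹ • u, ‖u‖⁻¹ • w]
  have hf : Orthonormal ℝ (Set.domRestrict (Set.range (Sum.inr : Fin 2 → Fin n ⊕ Fin 2)) f) := by
    constructor
    · rintro ⟨_, k, rfl⟩
      fin_cases k <;> simp [f, norm_smul, hnw, hr.ne']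
    · rintro ⟨_, k, rfl⟩ ⟨_, l, rfl⟩ hkl
      fin_cases k <;> fin_cases l <;> first
        | exact absurd rfl hkl
        | simp [f, inner_smul_left, inner_smul_right, him, real_inner_comm]
  obtain ⟨b, hb⟩ := hf.exists_orthonormalBasis_extension_of_card_eq (by simp)
  let A : Matrix (Fin n ⊕ Fin 2) (Fin n ⊕ Fin 2) ℝ := Matrix.of fun i j => b j i
  have hA : A ∈ Matrix.orthogonalGroup (Fin n ⊕ Fin 2) ℝ := by
    rw [Matrix.mem_orthogonalGroup_iff']
    ext i j
    have := orthonormal_iff_ite.1 b.orthonormal j i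
    simp only [PiLp.inner_apply] at this
    simp only [Matrix.mul_apply, A, Matrix.of_apply, Matrix.one_apply]
    simpa [eq_comm] using this
  refine ⟨⟨A, hA⟩, ?_⟩
  rw [← mk_rep x]
  refine mk_eq_mk ((‖u‖⁻¹ : ℝ) : ℂ) ?_
  have hb0 : b (Sum.inr 0) = ‖u‖⁻¹ • u := hb _ ⟨0, rfl⟩
  have hb1 : b (Sum.inr 1) = ‖u‖⁻¹ • w := hb _ ⟨1, rfl⟩
  rw [← hv]
  funext k
  simp only [act, Matrix.mulVec, dotProduct, Fintype.sum_sum_type, Fin.sum_univ_two, param,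
    Matrix.map_apply, A, Matrix.of_apply, hb0, hb1]
  apply Complex.ext <;> simp [u, w]

/-- An orthogonal matrix that carries the base point to `x`. -/
def frame (x : Hyperquadric n) : Orth n := (exists_orth x).choose

theorem point_frame (x : Hyperquadric n) : point (frame x) 0 = x := (exists_orth x).choose_spec

/-- The hyperquadric is a manifold modelled on `ℂ^n`; the preferred chart at `x` is centred
at `x`. -/
instance : ChartedSpace (Fin n → ℂ) (Hyperquadric n) where
  atlas := Set.range chart
  chartAt x := chart (frame x)
  mem_chart_source x := by
    have : point (frame x) 0 ∈ (chart (frame x)).source :=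
      (chart (frame x)).map_target (Set.mem_univ _)
    rwa [point_frame] at this
  chart_mem_atlas x := ⟨_, rfl⟩

/-- The hyperquadric is a complex manifold: the coordinate changes are holomorphic. -/
instance : IsManifold 𝓘(ℂ, Fin n → ℂ) ω (Hyperquadric n) := by
  refine isManifold_of_contDiffOn _ _ _ ?_
  rintro _ _ ⟨A, rfl⟩ ⟨B, rfl⟩
  have hpar : ContDiff ℂ ω
      (fun z : Fin n → ℂ => act B.1ᵀ (act A (param z))) := by
    have h1 : ContDiff ℂ ω (param : (Fin n → ℂ) → _) := by
      refine contDiff_pi.2 fun k => ?_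
      rcases k with i | k
      · simp only [param, Sum.elim_inl]; fun_prop
      · fin_cases k <;> simp only [param, Sum.elim_inr, dotProduct, Fin.zero_eta, Fin.mk_one,
          Matrix.cons_val_zero, Matrix.cons_val_one] <;> fun_prop
    simp only [act_mul]
    exact (LinearMap.toContinuousLinearMap
      (Matrix.mulVecLin ((B.1ᵀ * A.1).map Complex.ofReal))).contDiff.comp h1
  have hden : ∀ z : Fin n → ℂ, den (act B.1ᵀ (point A z).1.rep) ≠ 0 →
      den (act B.1ᵀ (act A (param z))) ≠ 0 := by
    intro z hz h
    obtain ⟨c, hc, hr⟩ := rep_point A z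
    rw [hr, act_smul, den_smul, h] at hz
    simp at hz
  have hmain : ContDiffOn ℂ ω (fun z => coord (act B.1ᵀ (act A (param z))))
      {z : Fin n → ℂ | den (act B.1ᵀ (point A z).1.rep) ≠ 0} := by
    refine contDiffOn_pi.2 fun i => ?_
    refine ContDiffOn.div ?_ ?_ fun z hz => hden z hz
    · exact (contDiff_const.mul (contDiff_pi.1 hpar _)).contDiffOn
    · exact ((contDiff_pi.1 hpar _).sub (contDiff_const.mul (contDiff_pi.1 hpar _))).contDiffOn
  refine (hmain.congr fun z hz => ?_).mono fun z hz => ?_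
  · obtain ⟨c, hc, hr⟩ := rep_point A z
    change coord (act B.1ᵀ (point A z).1.rep) = _
    rw [hr, act_smul, coord_smul hc]
  · simpa [chart] using hz

open RiemannianChart Bisectional

/-- The complex structure on the tangent spaces: multiplication by `√-1` in holomorphic charts. -/
def complexStructure (x : Hyperquadric n) :
    Module.End ℝ (TangentSpace 𝓘(ℝ, Fin n → ℂ) x) :=
  let J : (Fin n → ℂ) →ₗ[ℝ] (Fin n → ℂ) :=
    (Complex.I • (LinearMap.id : (Fin n → ℂ) →ₗ[ℂ] (Fin n → ℂ))).restrictScalars ℝ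
  J

/-! ### The Hermitian symmetric metric -/

/-- The element of `𝔭 ⊆ 𝔰𝔬(n+2)` that corresponds to a real `2 × n` matrix `X`. -/
def pMatrix (X : Matrix (Fin 2) (Fin n) ℝ) : Matrix (Fin n ⊕ Fin 2) (Fin n ⊕ Fin 2) ℝ :=
  Matrix.fromBlocks 0 (-Xᵀ) X 0

theorem exp_mem (X : Matrix (Fin 2) (Fin n) ℝ) :
    NormedSpace.exp (pMatrix X) ∈ Matrix.specialOrthogonalGroup (Fin n ⊕ Fin 2) ℝ := by
  have horth : ∀ Y : Matrix (Fin 2) (Fin n) ℝ,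
      (NormedSpace.exp (pMatrix Y))ᵀ * NormedSpace.exp (pMatrix Y) = 1 := by
    intro Y
    have hskew : (pMatrix Y)ᵀ = -pMatrix Y := by
      simp [pMatrix, Matrix.fromBlocks_transpose, Matrix.fromBlocks_neg]
    rw [← Matrix.exp_transpose, hskew, Matrix.exp_neg]
    exact Matrix.nonsing_inv_mul _ ((Matrix.isUnit_iff_isUnit_det _).1 (Matrix.isUnit_exp _))
  refine Matrix.mem_specialOrthogonalGroup_iff.2 ⟨?_, ?_⟩
  · rw [Matrix.mem_orthogonalGroup_iff']
    simpa [Matrix.star_eq_conjTranspose] using horth X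
  · have h2 : NormedSpace.exp (pMatrix X)
        = NormedSpace.exp (pMatrix ((1 / 2 : ℝ) • X)) ^ 2 := by
      rw [← Matrix.exp_nsmul]
      congr 1
      have h3 : (1 / 2 : ℝ) • X + (1 / 2 : ℝ) • X = X := by rw [← add_smul]; norm_num
      have h4 : (1 / 2 : ℝ) • Xᵀ + (1 / 2 : ℝ) • Xᵀ = Xᵀ := by rw [← add_smul]; norm_num
      rw [two_nsmul, pMatrix, pMatrix, Matrix.fromBlocks_add, Matrix.transpose_smul, h3, add_zero,
        add_zero, ← neg_add, h4]
    have hd := congrArg Matrix.det (horth ((1 / 2 : ℝ) • X))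
    rw [Matrix.det_mul, Matrix.det_transpose, Matrix.det_one] at hd
    rw [h2, Matrix.det_pow, sq, hd]

/-- The element `exp X` of `SO(n+2)`, for `X ∈ 𝔭`. -/
def expSO (X : Matrix (Fin 2) (Fin n) ℝ) : SOrth n := ⟨NormedSpace.exp (pMatrix X), exp_mem X⟩

theorem expSO_zero_base :
    rotate (toOrth (expSO ((0 : ℝ) • (0 : Matrix (Fin 2) (Fin n) ℝ)))) (base n) = base n := by
  have : (toOrth (expSO ((0 : ℝ) • (0 : Matrix (Fin 2) (Fin n) ℝ)))) = 1 := by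
    apply Subtype.ext
    simp [expSO, toOrth, pMatrix]
  rw [this, rotate_one]

theorem expSO_zero_smul_base (X : Matrix (Fin 2) (Fin n) ℝ) :
    rotate (toOrth (expSO ((0 : ℝ) • X))) (base n) = base n := by
  rw [zero_smul, ← zero_smul ℝ (0 : Matrix (Fin 2) (Fin n) ℝ)]
  exact expSO_zero_base

/-- The identification of `𝔭` with the tangent space at the base point: the velocity at `t = 0` of
the curve `exp(t X) · base`. -/
def pTangent (X : Matrix (Fin 2) (Fin n) ℝ) : TangentSpace 𝓘(ℝ, Fin n → ℂ) (base n) :=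
  velocityAt (fun t : ℝ => rotate (toOrth (expSO (t • X))) (base n)) (expSO_zero_smul_base X)

/-- `g` is the Hermitian symmetric metric with normalization constant `c`: it is a Riemannian
metric on the hyperquadric, invariant under `SO(n+2)`, and at the base point, where the tangent
space is identified with `𝔭`, it is the multiple `-c • tr(ξ η)` of the Killing form. -/
structure IsHermitianSymmetricMetric (c : ℝ)
    (g : MetricField (Fin n → ℂ) (Hyperquadric n)) : Prop where
  riemannian : IsRiemannianMetric g
  invariant : ∀ (A : SOrth n) (x : Hyperquadric n) (u v : TangentSpace 𝓘(ℝ, Fin n → ℂ) x),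
    g (rotate (toOrth A) x)
      (mfderiv 𝓘(ℝ, Fin n → ℂ) 𝓘(ℝ, Fin n → ℂ) (rotate (toOrth A)) x u)
      (mfderiv 𝓘(ℝ, Fin n → ℂ) 𝓘(ℝ, Fin n → ℂ) (rotate (toOrth A)) x v) = g x u v
  base : ∀ X Y : Matrix (Fin 2) (Fin n) ℝ,
    g (base n) (pTangent X) (pTangent Y) = -c * (pMatrix X * pMatrix Y).trace

end

end Hyperquadric

/-! ## Maps into the hyperquadric and their derivatives -/

namespace Hyperquadric

noncomputable section

open RiemannianChart Bisectional

variable {n : ℕ}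

/-! The metric is the Fubini–Study metric restricted to the quadric and rescaled. Real orthogonal
matrices act unitarily on `ℂ^{n+2}`, so the Fubini–Study form, lifted to the cone, is invariant
under them (`fubiniStudy_act`). The preferred charts are rotations of one affine chart, each centred
at its point; hence the metric has the same coordinate expression `affineMetric` in all of them and
equals `2c Re⟨u,w⟩` at every centre. Conversely, `SO(n+2)` is transitive and `𝔭` fills the tangent
space at the base point, so invariance and the trace formula determine `g`
(`IsHermitianSymmetricMetric.eq_standardMetric`).

It remains to find the curvature at the origin of one chart. Along a line `t ↦ t z` the metric is a
function of `t ^ 2`, so its first derivatives vanish at the origin and only second derivatives enter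
the curvature (`curvature_of_fderiv_eq_zero`). They follow from the values on lines by polarization.
The outcome, `curvature_affineMetric`, is `R(u, iu)w = -i A_u w` with `A_u w = |u|² w + ⟨w,u⟩ u -
(w·u) ū`.

For `U = u - iJu` the operator `R(U, Ū)` is `2 A_u` on the holomorphic part. The operator `A_u` is
Hermitian, and `⟨A_u w, w⟩ = |u|²|w|² + |⟨w,u⟩|² - |⟨w,ū⟩|²` is nonnegative by Cauchy–Schwarz. If
`A_u w = 0`, then `⟨w,u⟩ = 0`, and `|u|² w = (w·u) ū` puts `w` on the line of `ū`. Thus the kernel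
is at most a line, at most one eigenvalue vanishes, and the two smallest have positive sum. -/

theorem act_add (A : Matrix (Fin n ⊕ Fin 2) (Fin n ⊕ Fin 2) ℝ) (v w : Fin n ⊕ Fin 2 → ℂ) :
    act A (v + w) = act A v + act A w := by
  simp [act, Matrix.mulVec_add]

theorem star_act (A : Matrix (Fin n ⊕ Fin 2) (Fin n ⊕ Fin 2) ℝ) (v : Fin n ⊕ Fin 2 → ℂ) :
    star (act A v) = act A (star v) := by
  funext k
  simp [act, Matrix.mulVec, dotProduct]

/-- The action of a real matrix on `ℂ^{n+2}` as a continuous real linear map. -/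
def actL (A : Matrix (Fin n ⊕ Fin 2) (Fin n ⊕ Fin 2) ℝ) :
    (Fin n ⊕ Fin 2 → ℂ) →L[ℝ] (Fin n ⊕ Fin 2 → ℂ) :=
  LinearMap.toContinuousLinearMap
    { toFun := act A
      map_add' := act_add A
      map_smul' := fun c v => by
        have := act_smul A (c : ℂ) v
        simpa using this }

@[simp] theorem actL_apply (A : Matrix (Fin n ⊕ Fin 2) (Fin n ⊕ Fin 2) ℝ)
    (v : Fin n ⊕ Fin 2 → ℂ) : actL A v = act A v := rfl

theorem param_zero_inl (i : Fin n) : param (0 : Fin n → ℂ) (Sum.inl i) = 0 := rfl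

/-- Both `v` and the rotated `param 0` represent `x`, so they are proportional; since `den (param 0)
= 2`, the factor can be read off from `den`. -/
theorem frame_transpose_act (x : Hyperquadric n) (v : Fin n ⊕ Fin 2 → ℂ) (hv : v ≠ 0)
    (h : v ⬝ᵥ v = 0) (hx : mk v hv h = x) :
    den (act (frame x).1ᵀ v) ≠ 0 ∧
      act (frame x).1ᵀ v = (den (act (frame x).1ᵀ v) / 2) • param 0 := by
  have h1 : mk v hv h = point (frame x) 0 := by rw [point_frame, hx]
  obtain ⟨c, hc⟩ := (Projectivization.mk_eq_mk_iff' ℂ v _ hv _).1 (congrArg Subtype.val h1)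
  have hc0 : c ≠ 0 := by
    rintro rfl
    exact hv (by rw [← hc, zero_smul])
  have h2 : act (frame x).1ᵀ v = c • param 0 := by
    rw [← hc, act_smul, act_transpose_act]
  rw [h2, den_smul, den_param]
  refine ⟨by simpa using hc0, ?_⟩
  rw [mul_div_cancel_right₀ _ two_ne_zero]

/-- The tangent vector at `x = [v]`, in the preferred chart, of a curve in the cone over the
hyperquadric with velocity `a` at `v`. -/
def tangentOf (x : Hyperquadric n) (v : Fin n ⊕ Fin 2 → ℂ) :
    (Fin n ⊕ Fin 2 → ℂ) →L[ℝ] (Fin n → ℂ) :=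
  ContinuousLinearMap.pi fun i =>
    (den (act (frame x).1ᵀ v) / 2)⁻¹ •
      (ContinuousLinearMap.proj (R := ℝ) (Sum.inl i)).comp (actL (frame x).1ᵀ)

theorem tangentOf_apply (x : Hyperquadric n) (v a : Fin n ⊕ Fin 2 → ℂ) (i : Fin n) :
    tangentOf x v a i
      = (den (act (frame x).1ᵀ v) / 2)⁻¹ * act (frame x).1ᵀ a (Sum.inl i) := rfl

theorem continuous_mk_comp {X : Type*} [TopologicalSpace X] {F : X → Fin n ⊕ Fin 2 → ℂ}
    (hF : Continuous F) (h0 : ∀ z, F z ≠ 0) (h : ∀ z, F z ⬝ᵥ F z = 0) :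
    Continuous fun z => mk (F z) (h0 z) (h z) := by
  refine continuous_induced_rng.2 ?_
  have h : Continuous fun z : X => (⟨F z, h0 z⟩ : {v : Fin n ⊕ Fin 2 → ℂ // v ≠ 0}) :=
    hF.subtype_mk _
  let tP : TopologicalSpace (ℙ ℂ (Fin n ⊕ Fin 2 → ℂ)) := TopologicalSpace.coinduced
      (Projectivization.mk' ℂ : {v : Fin n ⊕ Fin 2 → ℂ // v ≠ 0} → ℙ ℂ (Fin n ⊕ Fin 2 → ℂ))
      inferInstance
  exact continuous_coinduced_rng.comp h

section Maps

variable {X : Type*} [NormedAddCommGroup X] [NormedSpace ℝ X]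

/-- The affine coordinates are quotients whose numerators vanish at the centre of the chart, so the
derivative of the denominator drops out. -/
theorem hasFDerivAt_coord {x : Hyperquadric n} {F : X → Fin n ⊕ Fin 2 → ℂ}
    {F' : X →L[ℝ] Fin n ⊕ Fin 2 → ℂ} {p : X} (hF : HasFDerivAt F F' p) (hv : F p ≠ 0)
    (h : F p ⬝ᵥ F p = 0) (hx : mk (F p) hv h = x) :
    HasFDerivAt (fun z => coord (act (frame x).1ᵀ (F z))) ((tangentOf x (F p)).comp F') p := by
  obtain ⟨hd, he⟩ := frame_transpose_act x (F p) hv h hx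
  have hA := (actL (frame x).1ᵀ).hasFDerivAt.comp p hF
  have hA' := hasFDerivAt_pi'.1 hA
  refine hasFDerivAt_pi'.2 fun i => ?_
  have hden : DifferentiableAt ℝ (fun z => (den (act (frame x).1ᵀ (F z)))⁻¹) p := by
    refine DifferentiableAt.inv ?_ hd
    exact (hA' _).differentiableAt.sub ((hA' _).differentiableAt.const_mul _)
  have hmul := ((hA' (Sum.inl i)).const_mul (2 : ℂ)).mul hden.hasFDerivAt
  have h0 : act (frame x).1ᵀ (F p) (Sum.inl i) = 0 := by
    rw [he]; simp [param_zero_inl]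
  refine hmul.congr_fderiv ?_
  ext u
  simp [h0, tangentOf_apply]
  ring

theorem mk_congr {v w : Fin n ⊕ Fin 2 → ℂ} (hvw : v = w) (hv : v ≠ 0) (h : v ⬝ᵥ v = 0) :
    mk v hv h = mk w (hvw ▸ hv) (hvw ▸ h) := by
  subst hvw; rfl

theorem chart_mk (A : Orth n) {v : Fin n ⊕ Fin 2 → ℂ} (hv : v ≠ 0) (h : v ⬝ᵥ v = 0) :
    chart A (mk v hv h) = coord (act A.1ᵀ v) := by
  obtain ⟨c, hc, hr⟩ := rep_eq hv
  change coord (act A.1ᵀ (Projectivization.mk ℂ v hv).rep) = _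
  rw [hr, act_smul, coord_smul hc]

/-- Reduces manifold derivatives to derivatives in `ℂ^{n+2}`; it serves the inverse charts and,
through `velocityAt_of_lift`, the orbits of one-parameter groups. -/
theorem hasMFDerivAt_of_lift {f : X → Hyperquadric n} {F : X → Fin n ⊕ Fin 2 → ℂ}
    {F' : X →L[ℝ] Fin n ⊕ Fin 2 → ℂ} {p : X} (hFc : Continuous F) (h0 : ∀ z, F z ≠ 0)
    (h : ∀ z, F z ⬝ᵥ F z = 0) (hf : ∀ z, f z = mk (F z) (h0 z) (h z)) (hF : HasFDerivAt F F' p) :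
    HasMFDerivAt 𝓘(ℝ, X) 𝓘(ℝ, Fin n → ℂ) f p ((tangentOf (f p) (F p)).comp F') := by
  refine ⟨?_, ?_⟩
  · have : f = fun z => mk (F z) (h0 z) (h z) := funext hf
    rw [this]
    exact (continuous_mk_comp hFc h0 h).continuousAt
  · have key := hasFDerivAt_coord hF (h0 p) (h p) (hf p).symm
    refine HasFDerivAt.hasFDerivWithinAt ?_
    refine key.congr_of_eventuallyEq (Filter.Eventually.of_forall fun z => ?_)
    change chart (frame (f p)) (f z) = _
    rw [hf z, chart_mk]

theorem velocityAt_of_lift {f : ℝ → Hyperquadric n} {F : ℝ → Fin n ⊕ Fin 2 → ℂ}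
    {F' : Fin n ⊕ Fin 2 → ℂ} (hFc : Continuous F) (h0 : ∀ z, F z ≠ 0)
    (h : ∀ z, F z ⬝ᵥ F z = 0) (hf : ∀ z, f z = mk (F z) (h0 z) (h z)) (hF : HasDerivAt F F' 0)
    {x : Hyperquadric n} (hx : f 0 = x) :
    velocityAt f hx = (tangentOf x (F 0) F' : Fin n → ℂ) := by
  subst hx
  have := (hasMFDerivAt_of_lift hFc h0 h hf hF.hasFDerivAt).mfderiv
  change mfderiv 𝓘(ℝ, ℝ) 𝓘(ℝ, Fin n → ℂ) f 0 (1 : ℝ) = _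
  rw [this]
  change tangentOf (f 0) (F 0) ((ContinuousLinearMap.toSpanSingleton ℝ F') 1) = _
  simp

end Maps

/-! ### Derivatives of the inverse charts and of the rotations -/

theorem chart_frame_self (x : Hyperquadric n) : chart (frame x) x = 0 := by
  have := (chart (frame x)).right_inv (Set.mem_univ (0 : Fin n → ℂ))
  rwa [show (chart (frame x)).symm 0 = x from point_frame x] at this

/-- The derivative of `param`. -/
def paramDeriv (z : Fin n → ℂ) : (Fin n → ℂ) →L[ℝ] Fin n ⊕ Fin 2 → ℂ :=
  LinearMap.toContinuousLinearMap
    { toFun := fun u => Sum.elim u ![-(z ⬝ᵥ u) / 2, Complex.I * ((z ⬝ᵥ u) / 2)]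
      map_add' := fun u w => by
        funext k
        rcases k with i | k
        · simp
        · fin_cases k <;> simp [dotProduct_add] <;> ring
      map_smul' := fun r u => by
        funext k
        rcases k with i | k
        · simp
        · fin_cases k <;> simp [dotProduct_smul] <;> ring }

theorem paramDeriv_apply (z u : Fin n → ℂ) :
    paramDeriv z u = Sum.elim u ![-(z ⬝ᵥ u) / 2, Complex.I * ((z ⬝ᵥ u) / 2)] := rfl

theorem hasFDerivAt_dotProduct_self (z : Fin n → ℂ) (L : (Fin n → ℂ) →L[ℝ] ℂ)
    (hL : ∀ u, L u = 2 * (z ⬝ᵥ u)) : HasFDerivAt (fun z : Fin n → ℂ => z ⬝ᵥ z) L z := by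
  have h : ∀ i : Fin n, HasFDerivAt (fun z : Fin n → ℂ => z i)
      (ContinuousLinearMap.proj (R := ℝ) (φ := fun _ : Fin n => ℂ) i) z := fun i =>
    (ContinuousLinearMap.proj (R := ℝ) (φ := fun _ : Fin n => ℂ) i).hasFDerivAt
  have := HasFDerivAt.fun_sum (u := Finset.univ) fun i _ => (h i).mul (h i)
  refine this.congr_fderiv ?_
  refine ContinuousLinearMap.ext fun u => ?_
  rw [hL]
  simp [dotProduct, Finset.mul_sum, two_mul,
    Finset.sum_add_distrib]

theorem hasFDerivAt_param (z : Fin n → ℂ) :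
    HasFDerivAt (param : (Fin n → ℂ) → _) (paramDeriv z) z := by
  -- The functional `u ↦ 2 (z·u)` is `-4` times the component `-(z·u)/2` of `paramDeriv z u`, which
  -- supplies its continuity.
  let L : (Fin n → ℂ) →L[ℝ] ℂ := (-4 : ℂ) •
    (ContinuousLinearMap.proj (R := ℝ) (φ := fun _ : Fin n ⊕ Fin 2 => ℂ) (Sum.inr 0)).comp
      (paramDeriv z)
  have hL : ∀ u, L u = 2 * (z ⬝ᵥ u) := fun u => by simp [L, paramDeriv_apply]; ring
  have hq := hasFDerivAt_dotProduct_self z L hL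
  refine hasFDerivAt_pi'.2 fun k => ?_
  rcases k with i | k
  · exact (ContinuousLinearMap.proj (R := ℝ) (φ := fun _ : Fin n => ℂ) i).hasFDerivAt
  · fin_cases k
    · have := (hq.mul_const (4 : ℂ)⁻¹).const_sub 1
      refine (this.congr_fderiv ?_)
      ext u
      simp [hL, paramDeriv_apply]; ring
    · have := ((hq.mul_const (4 : ℂ)⁻¹).const_add 1).const_mul Complex.I
      refine (this.congr_fderiv ?_)
      ext u
      simp [hL, paramDeriv_apply]; ring

theorem mfderiv_chart_symm (x₀ : Hyperquadric n) (z : Fin n → ℂ) :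
    HasMFDerivAt 𝓘(ℝ, Fin n → ℂ) 𝓘(ℝ, Fin n → ℂ) (chartAt (Fin n → ℂ) x₀).symm z
      ((tangentOf ((chartAt (Fin n → ℂ) x₀).symm z) (act (frame x₀).1 (param z))).comp
        ((actL (frame x₀).1).comp (paramDeriv z))) :=
  hasMFDerivAt_of_lift (F := fun z => act (frame x₀).1 (param z))
    ((continuous_act _).comp continuous_param)
    (fun z => act_ne_zero _ (param_ne_zero z))
    (fun z => by rw [act_dotProduct_act]; exact param_null z) (fun _ => rfl)
    ((actL (frame x₀).1).hasFDerivAt.comp z (hasFDerivAt_param z))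

/-- Read in the chart centred at `x`, the rotation has the lift `z ↦ A · frame x · param z` to the
cone, and the chain rule for lifts applies. -/
theorem hasMFDerivAt_rotate (A : Orth n) (x : Hyperquadric n) :
    HasMFDerivAt 𝓘(ℝ, Fin n → ℂ) 𝓘(ℝ, Fin n → ℂ) (rotate A) x
      ((tangentOf (rotate A x) (act (A.1 * (frame x).1) (param 0))).comp
        ((actL (A.1 * (frame x).1)).comp (paramDeriv 0))) := by
  have hne : ∀ z : Fin n → ℂ, act (A.1 * (frame x).1) (param z) ≠ 0 := fun z => by
    rw [← act_mul]; exact act_ne_zero _ (act_ne_zero _ (param_ne_zero z))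
  have hnull : ∀ z : Fin n → ℂ,
      act (A.1 * (frame x).1) (param z) ⬝ᵥ act (A.1 * (frame x).1) (param z) = 0 := fun z => by
    rw [← act_mul, act_dotProduct_act, act_dotProduct_act]; exact param_null z
  have hlift : ∀ z : Fin n → ℂ, rotate A (point (frame x) z) = mk _ (hne z) (hnull z) :=
    fun z => by
      rw [point, rotate_mk]
      exact mk_congr (act_mul _ _ _) _ _
  have hx : rotate A x = mk _ (hne 0) (hnull 0) := by
    rw [← hlift 0, point_frame]
  have hF : HasFDerivAt (fun z : Fin n → ℂ => act (A.1 * (frame x).1) (param z))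
      ((actL (A.1 * (frame x).1)).comp (paramDeriv 0)) 0 :=
    (actL (A.1 * (frame x).1)).hasFDerivAt.comp 0 (hasFDerivAt_param 0)
  refine ⟨?_, ?_⟩
  · have hc : Continuous fun z : Fin n → ℂ => rotate A (point (frame x) z) := by
      simp only [hlift]
      exact continuous_mk_comp ((continuous_act _).comp continuous_param) hne hnull
    have := ((chart (frame x)).symm.continuousAt_iff_continuousAt_comp_right
      (f := rotate A) (x := x) (mem_chart_source (Fin n → ℂ) x)).2
    exact this hc.continuousAt
  · refine HasFDerivAt.hasFDerivWithinAt ?_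
    have key := hasFDerivAt_coord hF (hne 0) (hnull 0) hx.symm
    have h0 : extChartAt 𝓘(ℝ, Fin n → ℂ) x x = 0 := chart_frame_self x
    rw [h0]
    refine key.congr_of_eventuallyEq (Filter.Eventually.of_forall fun z => ?_)
    change chart (frame (rotate A x)) (rotate A (point (frame x) z)) = _
    rw [hlift z, chart_mk]

end

end Hyperquadric

/-! ## The Fubini–Study form and the Hermitian symmetric metric -/

namespace Hyperquadric

noncomputable section

open RiemannianChart Bisectional

variable {n : ℕ}

/-- The Fubini–Study Hermitian form at `[v]`, lifted to the punctured vector space. -/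
def fubiniStudy {ι : Type*} [Fintype ι] (v a b : ι → ℂ) : ℂ :=
  (a ⬝ᵥ star b) / (v ⬝ᵥ star v) - (a ⬝ᵥ star v) * (v ⬝ᵥ star b) / (v ⬝ᵥ star v) ^ 2

/-- A real orthogonal matrix commutes with conjugation, so it preserves the Hermitian product along
with the bilinear one. -/
theorem fubiniStudy_act (A : Orth n) (v a b : Fin n ⊕ Fin 2 → ℂ) :
    fubiniStudy (act A v) (act A a) (act A b) = fubiniStudy v a b := by
  simp only [fubiniStudy, star_act, act_dotProduct_act]

theorem dotProduct_star_self_ne_zero {ι : Type*} [Fintype ι] {v : ι → ℂ} (hv : v ≠ 0) :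
    v ⬝ᵥ star v ≠ 0 := by
  open scoped ComplexOrder in
  exact fun h => hv (dotProduct_self_star_eq_zero.1 h)

theorem sum_dotProduct (v w : Fin n ⊕ Fin 2 → ℂ) :
    v ⬝ᵥ w = (∑ i, v (Sum.inl i) * w (Sum.inl i))
      + (v (Sum.inr 0) * w (Sum.inr 0) + v (Sum.inr 1) * w (Sum.inr 1)) := by
  simp [dotProduct, Fintype.sum_sum_type, Fin.sum_univ_two]

/-- After rotation `v` becomes `l • param 0`. Tangency to the cone makes the last two coordinates of
`a` and `b` multiples of `(1, i)`, a direction that the Fubini–Study form kills. Only the first `n`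
coordinates remain, and the factor `2` is `|param 0|²`. -/
theorem tangentOf_dotProduct_star (x : Hyperquadric n) (v a b : Fin n ⊕ Fin 2 → ℂ) (hv : v ≠ 0)
    (h : v ⬝ᵥ v = 0) (hx : mk v hv h = x) (ha : v ⬝ᵥ a = 0) (hb : v ⬝ᵥ b = 0) :
    tangentOf x v a ⬝ᵥ star (tangentOf x v b) = 2 * fubiniStudy v a b := by
  obtain ⟨hd, he⟩ := frame_transpose_act x v hv h hx
  obtain ⟨l, hl⟩ : ∃ l, l = den (act (frame x).1ᵀ v) / 2 := ⟨_, rfl⟩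
  have hl0 : l ≠ 0 := by rw [hl]; exact div_ne_zero hd two_ne_zero
  obtain ⟨a', ha'⟩ : ∃ a', a' = act (frame x).1ᵀ a := ⟨_, rfl⟩
  obtain ⟨b', hb'⟩ : ∃ b', b' = act (frame x).1ᵀ b := ⟨_, rfl⟩
  rw [← hl] at he
  have hva : v = act (frame x).1 (l • param 0) := by rw [← he, act_act_transpose]
  have haa : a = act (frame x).1 a' := by rw [ha', act_act_transpose]
  have hbb : b = act (frame x).1 b' := by rw [hb', act_act_transpose]
  have hfs : fubiniStudy v a b = fubiniStudy (l • param 0) a' b' := by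
    rw [hva, haa, hbb, fubiniStudy_act]
  have hI : Complex.I * Complex.I = -1 := Complex.I_mul_I
  have tang : ∀ y y', y = act (frame x).1 y' → v ⬝ᵥ y = 0 →
      y' (Sum.inr 0) = -(Complex.I * y' (Sum.inr 1)) := by
    intro y y' hy h0
    rw [hva, hy, act_dotProduct_act, smul_dotProduct, sum_dotProduct] at h0
    have h1 := (mul_eq_zero.1 h0).resolve_left hl0
    simp [param] at h1
    linear_combination h1
  have ha0 := tang a a' haa ha
  have hb0 := tang b b' hbb hb
  have hsl : star l ≠ 0 := by simpa using hl0
  have lhs : tangentOf x v a ⬝ᵥ star (tangentOf x v b)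
      = l⁻¹ * (star l)⁻¹ * ∑ i, a' (Sum.inl i) * star (b' (Sum.inl i)) := by
    simp only [dotProduct, Pi.star_apply, tangentOf_apply, ← hl, ← ha', ← hb', Finset.mul_sum]
    refine Finset.sum_congr rfl fun i _ => ?_
    rw [star_mul, star_inv₀]
    ring
  rw [lhs, hfs]
  simp only [fubiniStudy, sum_dotProduct, Pi.star_apply, Pi.smul_apply, param_zero_inl,
    smul_eq_mul, mul_zero, star_zero, zero_mul, Finset.sum_const_zero, zero_add]
  have e0 : param (0 : Fin n → ℂ) (Sum.inr 0) = 1 := by simp [param]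
  have e1 : param (0 : Fin n → ℂ) (Sum.inr 1) = Complex.I := by simp [param]
  have sI : star Complex.I = -Complex.I := by simp
  rw [e0, e1, ha0, hb0]
  simp only [star_mul, star_neg, sI, mul_one]
  have hN : l * star l + l * Complex.I * (-Complex.I * star l) = 2 * (l * star l) := by
    linear_combination -(l * star l) * hI
  rw [hN]
  field_simp
  have hI2 : Complex.I ^ 2 = -1 := Complex.I_sq
  generalize star (b' (Sum.inr 1)) = t
  simp only [hI2]
  ring_nf

/-- The real inner product `2 c Re ⟨u, w⟩` of `ℂ^n`. -/
def realForm (c : ℝ) : (Fin n → ℂ) →L[ℝ] (Fin n → ℂ) →L[ℝ] ℝ :=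
  LinearMap.toContinuousBilinearMap
    (LinearMap.mk₂ ℝ (fun u w => 2 * c * (u ⬝ᵥ star w).re)
      (fun u u' w => by simp [add_dotProduct]; ring)
      (fun r u w => by simp [smul_dotProduct]; ring)
      (fun u w w' => by simp [dotProduct_add]; ring)
      (fun r u w => by simp [dotProduct_smul]; ring))

theorem realForm_apply (c : ℝ) (u w : Fin n → ℂ) :
    realForm c u w = 2 * c * (u ⬝ᵥ star w).re := rfl

theorem dotProduct_star_comm {ι : Type*} [Fintype ι] (u w : ι → ℂ) :
    w ⬝ᵥ star u = star (u ⬝ᵥ star w) := by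
  simp [dotProduct, mul_comm]

theorem realForm_comm (c : ℝ) (u w : Fin n → ℂ) : realForm c u w = realForm c w u := by
  rw [realForm_apply, realForm_apply, dotProduct_star_comm u w]
  simp

theorem dotProduct_star_self {ι : Type*} [Fintype ι] (u : ι → ℂ) :
    u ⬝ᵥ star u = ((∑ i, Complex.normSq (u i) : ℝ) : ℂ) := by
  simp [dotProduct, Complex.mul_conj]

theorem realForm_pos {c : ℝ} (hc : 0 < c) {u : Fin n → ℂ} (hu : u ≠ 0) : 0 < realForm c u u := by
  have h := dotProduct_star_self_ne_zero hu
  rw [realForm_apply]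
  rw [dotProduct_star_self] at h ⊢
  have h2 : 0 ≤ ∑ i, Complex.normSq (u i) := Finset.sum_nonneg fun i _ => Complex.normSq_nonneg _
  have h3 : ∑ i, Complex.normSq (u i) ≠ 0 := by exact_mod_cast h
  have h4 := lt_of_le_of_ne h2 h3.symm
  rw [Complex.ofReal_re]
  positivity

/-- The Hermitian symmetric metric; in the charts centred at `x` it is the standard one at `x`. -/
def standardMetric (c : ℝ) : MetricField (Fin n → ℂ) (Hyperquadric n) := fun _ => realForm c

theorem standardMetric_apply (c : ℝ) (x : Hyperquadric n) (u w : Fin n → ℂ) :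
    standardMetric c x u w = 2 * c * (u ⬝ᵥ star w).re := rfl

theorem standardMetric_tangentOf (c : ℝ) (x : Hyperquadric n) (v a b : Fin n ⊕ Fin 2 → ℂ)
    (hv : v ≠ 0) (h : v ⬝ᵥ v = 0) (hx : mk v hv h = x) (ha : v ⬝ᵥ a = 0) (hb : v ⬝ᵥ b = 0) :
    standardMetric c x (tangentOf x v a) (tangentOf x v b) = 4 * c * (fubiniStudy v a b).re := by
  rw [standardMetric_apply, tangentOf_dotProduct_star x v a b hv h hx ha hb]
  simp
  ring

theorem param_dotProduct_paramDeriv (z u : Fin n → ℂ) : param z ⬝ᵥ paramDeriv z u = 0 := by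
  rw [sum_dotProduct, paramDeriv_apply]
  simp only [param, Sum.elim_inl, Sum.elim_inr, Matrix.cons_val_zero, Matrix.cons_val_one]
  change z ⬝ᵥ u + _ = 0
  linear_combination (1 + (z ⬝ᵥ z) / 4) * (z ⬝ᵥ u) / 2 * Complex.I_mul_I

/-- The Hermitian symmetric metric in affine coordinates. -/
def affineMetric (c : ℝ) (z : Fin n → ℂ) : (Fin n → ℂ) →L[ℝ] (Fin n → ℂ) →L[ℝ] ℝ :=
  metricInChart (standardMetric c) (base n) z

theorem metricInChart_standardMetric_apply (c : ℝ) (x₀ : Hyperquadric n) (z u w : Fin n → ℂ) :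
    metricInChart (standardMetric c) x₀ z u w =
      4 * c * (fubiniStudy (param z) (paramDeriv z u) (paramDeriv z w)).re := by
  have hne := act_ne_zero (frame x₀) (param_ne_zero z)
  have hnull : act (frame x₀).1 (param z) ⬝ᵥ act (frame x₀).1 (param z) = 0 := by
    rw [act_dotProduct_act, param_null]
  have ht : ∀ u, act (frame x₀).1 (param z) ⬝ᵥ act (frame x₀).1 (paramDeriv z u) = 0 :=
    fun u => by rw [act_dotProduct_act, param_dotProduct_paramDeriv]
  have := standardMetric_tangentOf c ((chartAt (Fin n → ℂ) x₀).symm z) _ _ _ hne hnull rfl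
    (ht u) (ht w)
  rw [fubiniStudy_act] at this
  rw [← this]
  simp only [metricInChart, (mfderiv_chart_symm x₀ z).mfderiv]
  rfl

/-- The rotation `frame x₀` cancels by unitary invariance. Smoothness and curvature thus concern a
single function on `ℂ^n`, and the base point used in `affineMetric` is immaterial. -/
theorem metricInChart_standardMetric (c : ℝ) (x₀ : Hyperquadric n) :
    metricInChart (standardMetric c) x₀ = affineMetric c := by
  funext z
  ext u w
  rw [affineMetric, metricInChart_standardMetric_apply, metricInChart_standardMetric_apply]

theorem affineMetric_apply (c : ℝ) (z u w : Fin n → ℂ) :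
    affineMetric c z u w =
      4 * c * (fubiniStudy (param z) (paramDeriv z u) (paramDeriv z w)).re :=
  metricInChart_standardMetric_apply c _ z u w

/-! ### Smoothness, positivity and invariance -/

theorem contDiff_dotProduct_star {X ι : Type*} [Fintype ι] [NormedAddCommGroup X]
    [NormedSpace ℝ X] {a b : X → ι → ℂ} (ha : ContDiff ℝ ∞ a) (hb : ContDiff ℝ ∞ b) :
    ContDiff ℝ ∞ fun z => a z ⬝ᵥ star (b z) := by
  refine ContDiff.sum fun i _ => (contDiff_pi.1 ha i).mul ?_
  exact Complex.conjCLE.contDiff.comp (contDiff_pi.1 hb i)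

theorem contDiff_dotProduct {X ι : Type*} [Fintype ι] [NormedAddCommGroup X]
    [NormedSpace ℝ X] {a b : X → ι → ℂ} (ha : ContDiff ℝ ∞ a) (hb : ContDiff ℝ ∞ b) :
    ContDiff ℝ ∞ fun z => a z ⬝ᵥ b z :=
  ContDiff.sum fun i _ => (contDiff_pi.1 ha i).mul (contDiff_pi.1 hb i)

theorem contDiff_param : ContDiff ℝ ∞ (param : (Fin n → ℂ) → _) := by
  have hq : ContDiff ℝ ∞ fun z : Fin n → ℂ => z ⬝ᵥ z := contDiff_dotProduct contDiff_id contDiff_id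
  refine contDiff_pi.2 fun k => ?_
  rcases k with i | k
  · exact contDiff_apply ℝ ℂ i
  · fin_cases k
    · exact contDiff_const.sub (hq.mul contDiff_const)
    · exact contDiff_const.mul (contDiff_const.add (hq.mul contDiff_const))

theorem contDiff_paramDeriv (u : Fin n → ℂ) :
    ContDiff ℝ ∞ fun z : Fin n → ℂ => paramDeriv z u := by
  have hq : ContDiff ℝ ∞ fun z : Fin n → ℂ => z ⬝ᵥ u :=
    contDiff_dotProduct contDiff_id contDiff_const
  refine contDiff_pi.2 fun k => ?_
  rcases k with i | k
  · exact contDiff_const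
  · fin_cases k
    · exact hq.neg.mul contDiff_const
    · exact contDiff_const.mul (hq.mul contDiff_const)

theorem contDiff_affineMetric (c : ℝ) :
    ContDiff ℝ ∞ (affineMetric c : (Fin n → ℂ) → _) := by
  refine contDiff_clm_apply_iff.2 fun u => contDiff_clm_apply_iff.2 fun w => ?_
  simp only [affineMetric_apply]
  have hu := contDiff_paramDeriv u
  have hw := contDiff_paramDeriv w
  have hp := contDiff_param (n := n)
  have h0 := fun z : Fin n → ℂ => dotProduct_star_self_ne_zero (param_ne_zero z)
  have hN := contDiff_dotProduct_star hp hp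
  have hf : ContDiff ℝ ∞ fun z => fubiniStudy (param z) (paramDeriv z u) (paramDeriv z w) := by
    simp only [fubiniStudy, div_eq_mul_inv]
    exact ((contDiff_dotProduct_star hu hw).mul (hN.inv h0)).sub
      (((contDiff_dotProduct_star hu hp).mul (contDiff_dotProduct_star hp hw)).mul
        ((hN.pow 2).inv fun z => pow_ne_zero 2 (h0 z)))
  exact contDiff_const.mul (Complex.reCLM.contDiff.comp hf)

theorem isRiemannianMetric_standardMetric {c : ℝ} (hc : 0 < c) :
    IsRiemannianMetric (standardMetric c : MetricField (Fin n → ℂ) (Hyperquadric n)) where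
  symm _ u v := realForm_comm c u v
  pos _ _ hu := realForm_pos hc hu
  smooth x₀ := by
    rw [metricInChart_standardMetric]
    exact (contDiff_affineMetric c).contDiffOn

theorem paramDeriv_zero_apply (u : Fin n → ℂ) : paramDeriv 0 u = Sum.elim u 0 := by
  rw [paramDeriv_apply]
  congr 1
  funext k
  fin_cases k <;> simp

theorem param_zero_dotProduct_star_self : param (0 : Fin n → ℂ) ⬝ᵥ star (param 0) = 2 := by
  rw [sum_dotProduct]
  simp [param]
  norm_num

theorem fubiniStudy_param_zero (a b : Fin n → ℂ) :
    fubiniStudy (param 0) (Sum.elim a 0) (Sum.elim b 0) = (a ⬝ᵥ star b) / 2 := by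
  rw [fubiniStudy, param_zero_dotProduct_star_self]
  simp [sum_dotProduct, param]
  rfl

/-- Both sides are `4c Re` of the Fubini–Study form at `param 0`: the left one after removing the
orthogonal matrix `B = A · frame x`, the right one because `fubiniStudy_param_zero` identifies it
with half the standard product. -/
theorem standardMetric_mfderiv_rotate (c : ℝ) (A : Orth n) (x : Hyperquadric n)
    (u v : Fin n → ℂ) :
    standardMetric c (rotate A x)
      (mfderiv 𝓘(ℝ, Fin n → ℂ) 𝓘(ℝ, Fin n → ℂ) (rotate A) x u)
      (mfderiv 𝓘(ℝ, Fin n → ℂ) 𝓘(ℝ, Fin n → ℂ) (rotate A) x v) = standardMetric c x u v := by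
  obtain ⟨B, hB⟩ : ∃ B : Orth n, B = A * frame x := ⟨_, rfl⟩
  have hB' : A.1 * (frame x).1 = B.1 := by rw [hB]; rfl
  have hx : point B 0 = rotate A x := by
    conv_rhs => rw [← point_frame x, point, rotate_mk]
    exact mk_congr (by rw [act_mul, hB']) _ _
  rw [(hasMFDerivAt_rotate A x).mfderiv, hB']
  have ht : ∀ u, act B.1 (param 0) ⬝ᵥ act B.1 (paramDeriv 0 u) = 0 :=
    fun u => by rw [act_dotProduct_act, param_dotProduct_paramDeriv]
  have := standardMetric_tangentOf c (rotate A x) (act B.1 (param 0)) _ _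
    (act_ne_zero B (param_ne_zero 0)) _ hx (ht u) (ht v)
  refine this.trans ?_
  rw [fubiniStudy_act, paramDeriv_zero_apply, paramDeriv_zero_apply, fubiniStudy_param_zero]
  rw [standardMetric_apply]
  simp
  ring

/-! ### The metric at the base point on `𝔭` -/

theorem act_pMatrix_param_zero (X : Matrix (Fin 2) (Fin n) ℝ) :
    act (pMatrix X) (param 0) =
      Sum.elim (fun i => -((X 0 i : ℂ) + X 1 i * Complex.I)) 0 := by
  funext k
  rcases k with i | k
  · simp [act, pMatrix, Matrix.mulVec, dotProduct, Fintype.sum_sum_type, Fin.sum_univ_two, param]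
  · simp [act, pMatrix, Matrix.mulVec, dotProduct, Fintype.sum_sum_type, param]

theorem pMatrix_smul (t : ℝ) (X : Matrix (Fin 2) (Fin n) ℝ) : pMatrix (t • X) = t • pMatrix X := by
  simp [pMatrix, Matrix.fromBlocks_smul]

theorem hasDerivAt_act_exp (P : Matrix (Fin n ⊕ Fin 2) (Fin n ⊕ Fin 2) ℝ) (v : Fin n ⊕ Fin 2 → ℂ)
    (t : ℝ) :
    HasDerivAt (fun t : ℝ => act (NormedSpace.exp (t • P)) v)
      (act (NormedSpace.exp (t • P) * P) v) t := by
  -- Any submultiplicative norm serves to differentiate the exponential; in finite dimension the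
  -- choice does not affect the derivative.
  let _ : NormedRing (Matrix (Fin n ⊕ Fin 2) (Fin n ⊕ Fin 2) ℝ) := Matrix.linftyOpNormedRing
  let _ : NormedAlgebra ℝ (Matrix (Fin n ⊕ Fin 2) (Fin n ⊕ Fin 2) ℝ) := Matrix.linftyOpNormedAlgebra
  have h := hasDerivAt_exp_smul_const (𝕂 := ℝ) P t
  let L : Matrix (Fin n ⊕ Fin 2) (Fin n ⊕ Fin 2) ℝ →ₗ[ℝ] (Fin n ⊕ Fin 2 → ℂ) :=
    { toFun := fun A => act A v
      map_add' := fun A B => by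
        funext k; simp [act, Matrix.mulVec, dotProduct, add_mul, Finset.sum_add_distrib]
      map_smul' := fun r A => by
        funext k; simp [act, Matrix.mulVec, dotProduct, Finset.mul_sum, mul_assoc] }
  exact (LinearMap.toContinuousLinearMap L).hasFDerivAt.comp_hasDerivAt t h

/-- The curve `exp(tP) · param 0` lifts the orbit to the cone, and its velocity at `0` is `P · param
0`. -/
theorem pTangent_eq (X : Matrix (Fin 2) (Fin n) ℝ) :
    pTangent X = (tangentOf (base n) (param 0) (act (pMatrix X) (param 0)) : Fin n → ℂ) := by
  have hF := fun t => hasDerivAt_act_exp (pMatrix X) (act (1 : Orth n).1 (param 0)) t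
  have hc : Continuous fun t : ℝ =>
      act (NormedSpace.exp (t • pMatrix X)) (act (1 : Orth n).1 (param 0)) :=
    continuous_iff_continuousAt.2 fun t => (hF t).continuousAt
  have hlift : ∀ t : ℝ, act (toOrth (expSO (t • X))).1 (act (1 : Orth n).1 (param 0)) =
      act (NormedSpace.exp (t • pMatrix X)) (act (1 : Orth n).1 (param 0)) := fun t => by
    rw [← pMatrix_smul]; rfl
  have h0 : act (NormedSpace.exp ((0 : ℝ) • pMatrix X)) (act (1 : Orth n).1 (param 0)) =
      param 0 := by
    rw [zero_smul, NormedSpace.exp_zero, act_one]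
    exact act_one _
  have h1 : act (NormedSpace.exp ((0 : ℝ) • pMatrix X) * pMatrix X)
      (act (1 : Orth n).1 (param 0)) = act (pMatrix X) (param 0) := by
    rw [zero_smul, NormedSpace.exp_zero, one_mul]
    exact congrArg _ (act_one _)
  have := velocityAt_of_lift (f := fun t : ℝ => rotate (toOrth (expSO (t • X))) (base n)) hc
    (fun t => by
      rw [← hlift]
      exact act_ne_zero _ (act_ne_zero 1 (param_ne_zero 0)))
    (fun t => by
      rw [← hlift, act_dotProduct_act]
      exact (act_dotProduct_act 1 _ _).trans (param_null 0))
    (fun t => by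
      rw [base, point, rotate_mk]
      exact mk_congr (hlift t) _ _)
    (hF 0) (expSO_zero_smul_base X)
  rw [h0, h1] at this
  exact this

theorem trace_pMatrix_mul (X Y : Matrix (Fin 2) (Fin n) ℝ) :
    (pMatrix X * pMatrix Y).trace = -2 * ∑ i, (X 0 i * Y 0 i + X 1 i * Y 1 i) := by
  simp only [pMatrix, Matrix.fromBlocks_multiply, Matrix.trace, Fintype.sum_sum_type]
  simp [Matrix.mul_apply, Fin.sum_univ_two, Finset.sum_add_distrib]
  ring

theorem base_eq_mk : mk (param 0) (param_ne_zero 0) (param_null 0) = base n :=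
  mk_congr (act_one _).symm _ _

theorem standardMetric_pTangent (c : ℝ) (X Y : Matrix (Fin 2) (Fin n) ℝ) :
    standardMetric c (base n) (pTangent X) (pTangent Y) =
      -c * (pMatrix X * pMatrix Y).trace := by
  have ht : ∀ X : Matrix (Fin 2) (Fin n) ℝ, param 0 ⬝ᵥ act (pMatrix X) (param 0) = 0 := fun X => by
    rw [act_pMatrix_param_zero, sum_dotProduct]
    simp [param]
  rw [pTangent_eq, pTangent_eq]
  refine (standardMetric_tangentOf c (base n) (param 0) _ _ _ _ base_eq_mk (ht X) (ht Y)).trans ?_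
  rw [act_pMatrix_param_zero, act_pMatrix_param_zero, fubiniStudy_param_zero, trace_pMatrix_mul]
  simp [dotProduct]
  ring

theorem isHermitianSymmetricMetric_standardMetric {c : ℝ} (hc : 0 < c) :
    IsHermitianSymmetricMetric c
      (standardMetric c : MetricField (Fin n → ℂ) (Hyperquadric n)) where
  riemannian := isRiemannianMetric_standardMetric hc
  invariant A x u v := standardMetric_mfderiv_rotate c (toOrth A) x u v
  base := standardMetric_pTangent c

/-! ### Uniqueness -/

/-- The metric pulls back to a positive sum of squares of the entries of `X`, so the map is
injective; both spaces have real dimension `2n`. -/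
theorem pTangent_surjective : Function.Surjective (pTangent (n := n)) := by
  let T : Matrix (Fin 2) (Fin n) ℝ →ₗ[ℝ] (Fin n → ℂ) :=
    { toFun := fun X => tangentOf (base n) (param 0) (act (pMatrix X) (param 0))
      map_add' := fun X Y => by
        rw [← map_add]
        congr 1
        simp only [act_pMatrix_param_zero]
        funext k
        rcases k with i | k
        · simp; ring
        · simp
      map_smul' := fun r X => by
        rw [RingHom.id_apply, ← map_smul]
        congr 1
        simp only [act_pMatrix_param_zero]
        funext k
        rcases k with i | k
        · simp; ring
        · simp }
  have hT : ∀ X, T X = pTangent X := fun X => (pTangent_eq X).symm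
  have hinj : Function.Injective T := by
    refine (injective_iff_map_eq_zero T).2 fun X hX => ?_
    have h := standardMetric_pTangent 1 X X
    rw [← hT, hX, trace_pMatrix_mul] at h
    have h1 : ∑ i, (X 0 i * X 0 i + X 1 i * X 1 i) = 0 := by
      have h2 : standardMetric 1 (base n) (0 : Fin n → ℂ) (0 : Fin n → ℂ) = 0 := by
        rw [standardMetric_apply]; simp
      have h3 := h2.symm.trans h
      linarith
    rw [Finset.sum_eq_zero_iff_of_nonneg fun i _ =>
      add_nonneg (mul_self_nonneg _) (mul_self_nonneg _)] at h1
    ext k i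
    have h2 := h1 i (Finset.mem_univ i)
    have h3 := (add_eq_zero_iff_of_nonneg (mul_self_nonneg _) (mul_self_nonneg _)).1 h2
    fin_cases k
    · exact mul_self_eq_zero.1 h3.1
    · exact mul_self_eq_zero.1 h3.2
  have hdim : Module.finrank ℝ (Matrix (Fin 2) (Fin n) ℝ) = Module.finrank ℝ (Fin n → ℂ) := by
    rw [Module.finrank_matrix, Module.finrank_pi_fintype]
    simp [mul_comm]
  intro u
  obtain ⟨X, hX⟩ := (LinearMap.injective_iff_surjective_of_finrank_eq_finrank hdim).1 hinj u
  exact ⟨X, (hT X).symm.trans hX⟩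

/-- The frame may have determinant `-1`. It is then composed with the reflection in one of the first
`n` coordinates, which fixes `param 0`; such a coordinate exists because `n ≥ 1`. -/
theorem exists_rotate_base (hn : 1 ≤ n) (x : Hyperquadric n) :
    ∃ A : SOrth n, rotate (toOrth A) (base n) = x := by
  have hdet : (frame x).1.det = 1 ∨ (frame x).1.det = -1 := by
    have := congrArg Matrix.det (transpose_mul_self (frame x))
    rw [Matrix.det_mul, Matrix.det_transpose, Matrix.det_one] at this
    exact mul_self_eq_one_iff.1 this
  obtain ⟨D, hD, hDe, hdet⟩ : ∃ D : Matrix (Fin n ⊕ Fin 2) (Fin n ⊕ Fin 2) ℝ,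
      D * Dᵀ = 1 ∧ act D (param 0) = param 0 ∧ (frame x).1.det * D.det = 1 := by
    rcases hdet with h | h
    · exact ⟨1, by simp, act_one _, by simp [h]⟩
    · let i₀ : Fin n := ⟨0, hn⟩
      let d : Fin n ⊕ Fin 2 → ℝ := fun k => if k = Sum.inl i₀ then -1 else 1
      refine ⟨Matrix.diagonal d, ?_, ?_, ?_⟩
      · rw [Matrix.diagonal_transpose, Matrix.diagonal_mul_diagonal, ← Matrix.diagonal_one]
        congr 1
        funext k
        simp only [d]
        split_ifs <;> norm_num
      · funext k
        rw [act, Matrix.diagonal_map Complex.ofReal_zero, Matrix.mulVec_diagonal]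
        rcases k with i | k
        · rw [param_zero_inl, mul_zero]
        · simp [d]
      · rw [Matrix.det_diagonal, Finset.prod_ite_eq' , h]
        simp
  have hmem : (frame x).1 * D ∈ Matrix.specialOrthogonalGroup (Fin n ⊕ Fin 2) ℝ := by
    refine Matrix.mem_specialOrthogonalGroup_iff.2 ⟨?_, by rw [Matrix.det_mul, hdet]⟩
    refine mul_mem (frame x).2 ?_
    rw [Matrix.mem_orthogonalGroup_iff]
    exact hD
  refine ⟨⟨_, hmem⟩, ?_⟩
  conv_rhs => rw [← point_frame x]
  rw [← base_eq_mk, rotate_mk]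
  refine mk_congr ?_ _ _
  change act ((frame x).1 * D) (param 0) = act (frame x).1 (param 0)
  rw [← act_mul, hDe]

/-- An isometry for a positive definite form is injective, hence surjective in equal finite
dimensions. -/
theorem mfderiv_rotate_surjective (A : Orth n) (x : Hyperquadric n) :
    Function.Surjective (mfderiv 𝓘(ℝ, Fin n → ℂ) 𝓘(ℝ, Fin n → ℂ) (rotate A) x) := by
  let T : (Fin n → ℂ) →L[ℝ] (Fin n → ℂ) :=
    mfderiv 𝓘(ℝ, Fin n → ℂ) 𝓘(ℝ, Fin n → ℂ) (rotate A) x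
  have hinj : Function.Injective (T : (Fin n → ℂ) →ₗ[ℝ] (Fin n → ℂ)) := by
    refine (injective_iff_map_eq_zero _).2 fun u hu => ?_
    by_contra h0
    have h1 : realForm 1 (T u) (T u) = realForm 1 u u := standardMetric_mfderiv_rotate 1 A x u u
    have h2 := realForm_pos one_pos h0
    have h3 : T u = 0 := hu
    rw [← h1, h3] at h2
    simp at h2
  exact (LinearMap.injective_iff_surjective (f := (T : (Fin n → ℂ) →ₗ[ℝ] (Fin n → ℂ)))).1 hinj

theorem IsHermitianSymmetricMetric.eq_standardMetric (hn : 1 ≤ n) {c : ℝ}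
    {g : MetricField (Fin n → ℂ) (Hyperquadric n)} (hg : IsHermitianSymmetricMetric c g) :
    g = standardMetric c := by
  funext x
  obtain ⟨A, rfl⟩ := exists_rotate_base hn x
  ext u v
  obtain ⟨u, rfl⟩ := mfderiv_rotate_surjective (toOrth A) (Hyperquadric.base n) u
  obtain ⟨v, rfl⟩ := mfderiv_rotate_surjective (toOrth A) (Hyperquadric.base n) v
  refine (hg.invariant A _ u v).trans
    (Eq.trans ?_ (standardMetric_mfderiv_rotate c (toOrth A) _ u v).symm)
  obtain ⟨X, rfl⟩ := pTangent_surjective u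
  obtain ⟨Y, rfl⟩ := pTangent_surjective v
  rw [hg.base, standardMetric_pTangent]

end

end Hyperquadric

/-! ## Curvature at a point where the metric is flat to first order -/

namespace RiemannianChart

noncomputable section

variable {E : Type*} [NormedAddCommGroup E] [NormedSpace ℝ E]

/-- The linear combination of derivatives of the metric that defines the Christoffel symbols of
the first kind. -/
def koszul : (E →L[ℝ] E →L[ℝ] E →L[ℝ] ℝ) →L[ℝ] (E →L[ℝ] E →L[ℝ] E →L[ℝ] ℝ) :=
  let fl : (E →L[ℝ] E →L[ℝ] E →L[ℝ] ℝ) →L[ℝ] (E →L[ℝ] E →L[ℝ] E →L[ℝ] ℝ) :=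
    ((ContinuousLinearMap.flipₗᵢ ℝ E E (E →L[ℝ] ℝ)).toContinuousLinearEquiv :
      (E →L[ℝ] E →L[ℝ] E →L[ℝ] ℝ) →L[ℝ] (E →L[ℝ] E →L[ℝ] E →L[ℝ] ℝ))
  let tr : (E →L[ℝ] E →L[ℝ] ℝ) →L[ℝ] (E →L[ℝ] E →L[ℝ] ℝ) :=
    ((ContinuousLinearMap.flipₗᵢ ℝ E E ℝ).toContinuousLinearEquiv :
      (E →L[ℝ] E →L[ℝ] ℝ) →L[ℝ] (E →L[ℝ] E →L[ℝ] ℝ))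
  (1 / 2 : ℝ) • (ContinuousLinearMap.id ℝ _ + fl -
    (ContinuousLinearMap.compL ℝ E (E →L[ℝ] E →L[ℝ] ℝ) (E →L[ℝ] E →L[ℝ] ℝ) tr).comp fl)

theorem koszul_apply (D : E →L[ℝ] E →L[ℝ] E →L[ℝ] ℝ) (u v w : E) :
    koszul D u v w = 1 / 2 * (D u v w + D v u w - D w u v) := by
  simp [koszul]

theorem christoffel_eq (G : E → E →L[ℝ] E →L[ℝ] ℝ) (z : E) :
    christoffel G z = (ContinuousLinearMap.compL ℝ E (E →L[ℝ] ℝ) E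
      (ContinuousLinearMap.inverse (G z))).comp (koszul (fderiv ℝ G z)) := rfl

/-- In the product rule, the term that differentiates the inverse metric is multiplied by the first
derivatives of `G`, which vanish at `p`. -/
theorem fderiv_christoffel_apply [CompleteSpace E] {G : E → E →L[ℝ] E →L[ℝ] ℝ} {p : E}
    (hG : ContDiffAt ℝ 2 G p) (h1 : fderiv ℝ G p = 0) (hinv : (G p).IsInvertible) (u v w : E) :
    fderiv ℝ (christoffel G) p u v w =
      ContinuousLinearMap.inverse (G p) (koszul (fderiv ℝ (fderiv ℝ G) p u) v w) := by
  have hi : DifferentiableAt ℝ (fun z => ContinuousLinearMap.inverse (G z)) p :=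
    ((hinv.contDiffAt_map_inverse (n := 2)).comp p hG).differentiableAt (by norm_num)
  have hc := (ContinuousLinearMap.compL ℝ E (E →L[ℝ] ℝ) E).hasFDerivAt.comp p hi.hasFDerivAt
  have hD : HasFDerivAt (fderiv ℝ G) (fderiv ℝ (fderiv ℝ G) p) p :=
    ((hG.fderiv_right (m := 1) (by norm_num)).differentiableAt (by norm_num)).hasFDerivAt
  have hK := (koszul (E := E)).hasFDerivAt.comp p hD
  have h : HasFDerivAt (christoffel G) _ p := hc.clm_comp hK
  rw [h.fderiv]
  simp [h1]

/-- The Christoffel tensor vanishes at `p`, so the quadratic terms disappear, and the two terms in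
`∂_u ∂_v G(w, y)` cancel by symmetry of second derivatives. -/
theorem curvature_of_fderiv_eq_zero [CompleteSpace E] {G : E → E →L[ℝ] E →L[ℝ] ℝ} {p : E}
    (hG : ContDiffAt ℝ 2 G p) (h1 : fderiv ℝ G p = 0) (hinv : (G p).IsInvertible) (u v w y : E) :
    2 * G p (curvature G p u v w) y =
      fderiv ℝ (fderiv ℝ G) p u w v y - fderiv ℝ (fderiv ℝ G) p u y v w
        - fderiv ℝ (fderiv ℝ G) p v w u y + fderiv ℝ (fderiv ℝ G) p v y u w := by
  have h0 : christoffel G p = 0 := by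
    rw [christoffel_eq, h1, map_zero, ContinuousLinearMap.comp_zero]
  have hs : fderiv ℝ (fderiv ℝ G) p u v = fderiv ℝ (fderiv ℝ G) p v u :=
    (hG.isSymmSndFDerivAt (by simp)).eq u v
  rw [curvature_apply, h0, fderiv_christoffel_apply hG h1 hinv,
    fderiv_christoffel_apply hG h1 hinv]
  obtain ⟨e, he⟩ := hinv
  rw [← he]
  simp [koszul_apply, hs]
  ring

theorem curvature_self (G : E → E →L[ℝ] E →L[ℝ] ℝ) (p u w : E) : curvature G p u u w = 0 := by
  rw [curvature_apply]; simp

theorem curvature_antisymm (G : E → E →L[ℝ] E →L[ℝ] ℝ) (p u v w : E) :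
    curvature G p u v w = -curvature G p v u w := by
  rw [curvature_apply, curvature_apply]; abel

/-- Differentiating `ψ(t²)` gives `2t ψ'(t²)`, which is `0` at `t = 0` and has derivative `2ψ'(0)`
there. -/
theorem fderiv_fderiv_of_even_line {G : E → E →L[ℝ] E →L[ℝ] ℝ} (hG : ContDiff ℝ 2 G)
    {z u w : E} {ψ : ℝ → ℝ} {d : ℝ} (hψ : ContDiffAt ℝ 2 ψ 0) (hd : HasDerivAt ψ d 0)
    (h : ∀ t : ℝ, G (t • z) u w = ψ (t ^ 2)) :
    fderiv ℝ G 0 z u w = 0 ∧ fderiv ℝ (fderiv ℝ G) 0 z z u w = 2 * d := by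
  have hl : ∀ t : ℝ, HasDerivAt (fun t : ℝ => t • z) z t := fun t => by
    simpa using (hasDerivAt_id t).smul_const z
  have hG1 : Differentiable ℝ G := hG.differentiable (by norm_num)
  have hG2 : Differentiable ℝ (fderiv ℝ G) :=
    (hG.fderiv_right (m := 1) (by norm_num)).differentiable (by norm_num)
  have d1 : ∀ t : ℝ, HasDerivAt (fun t : ℝ => G (t • z) u w) (fderiv ℝ G (t • z) z u w) t :=
    fun t => by
      have := (hG1 (t • z)).hasFDerivAt.comp_hasDerivAt t (hl t)
      simpa using (this.clm_apply (hasDerivAt_const t u)).clm_apply (hasDerivAt_const t w)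
  have d2 : HasDerivAt (fun t : ℝ => fderiv ℝ G (t • z) z u w)
      (fderiv ℝ (fderiv ℝ G) 0 z z u w) 0 := by
    have h0 := (hG2 ((0 : ℝ) • z)).hasFDerivAt.comp_hasDerivAt 0 (hl 0)
    rw [zero_smul] at h0
    simpa using ((h0.clm_apply (hasDerivAt_const (0 : ℝ) z)).clm_apply
      (hasDerivAt_const (0 : ℝ) u)).clm_apply (hasDerivAt_const (0 : ℝ) w)
  have hsq : ∀ t : ℝ, HasDerivAt (fun t : ℝ => t ^ 2) (2 * t) t := fun t => by
    simpa using hasDerivAt_pow 2 t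
  -- As `ψ` is only assumed regular near `0`, the formula for the first derivative is local; that
  -- suffices to differentiate once more at `0`.
  have hev : ∀ᶠ t in nhds (0 : ℝ), fderiv ℝ G (t • z) z u w = deriv ψ (t ^ 2) * (2 * t) := by
    have h1 : ∀ᶠ s in nhds ((0 : ℝ) ^ 2), ContDiffAt ℝ 2 ψ s := by
      rw [zero_pow two_ne_zero]
      exact hψ.eventually (by simp)
    filter_upwards [(hsq 0).continuousAt.eventually h1] with t ht
    have h2 := HasDerivAt.comp (h := fun t : ℝ => t ^ 2) t
      (ht.differentiableAt (by norm_num)).hasDerivAt (hsq t)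
    have h3 : (fun t : ℝ => G (t • z) u w) = ψ ∘ fun t => t ^ 2 := funext h
    exact (d1 t).unique (h3 ▸ h2)
  have hd' : deriv ψ 0 = d := hd.deriv
  refine ⟨by simpa using hev.self_of_nhds, ?_⟩
  have hψ' : DifferentiableAt ℝ (deriv ψ) ((0 : ℝ) ^ 2) := by
    rw [zero_pow two_ne_zero]
    exact ((hψ.fderiv_right (m := 1) (by norm_num)).differentiableAt (by norm_num)).clm_apply
      (differentiableAt_const (1 : ℝ))
  have h4 := (HasDerivAt.comp (h := fun t : ℝ => t ^ 2) (0 : ℝ) hψ'.hasDerivAt (hsq 0)).mul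
    ((hasDerivAt_id (0 : ℝ)).const_mul 2)
  have h5 := d2.unique (h4.congr_of_eventuallyEq hev)
  rw [h5]
  simp [hd']
  ring

end

end RiemannianChart

/-! ## The curvature of the hyperquadric -/

namespace Hyperquadric

noncomputable section

open RiemannianChart Bisectional

variable {n : ℕ}

theorem affineMetric_zero (c : ℝ) : affineMetric c (0 : Fin n → ℂ) = realForm c := by
  ext u w
  rw [affineMetric_apply, paramDeriv_zero_apply, paramDeriv_zero_apply, fubiniStudy_param_zero,
    realForm_apply]
  simp
  ring

theorem realForm_isInvertible {c : ℝ} (hc : 0 < c) :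
    (realForm c : (Fin n → ℂ) →L[ℝ] (Fin n → ℂ) →L[ℝ] ℝ).IsInvertible := by
  have hinj : Function.Injective (realForm c : (Fin n → ℂ) →L[ℝ] (Fin n → ℂ) →L[ℝ] ℝ) := by
    refine (injective_iff_map_eq_zero _).2 fun u hu => ?_
    by_contra h0
    have := realForm_pos hc h0
    rw [hu] at this
    simp at this
  have hdim : Module.finrank ℝ (Fin n → ℂ) = Module.finrank ℝ ((Fin n → ℂ) →L[ℝ] ℝ) := by
    rw [← (LinearMap.toContinuousLinearMap (𝕜 := ℝ) (E := Fin n → ℂ) (F' := ℝ)).finrank_eq]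
    exact (Subspace.dual_finrank_eq (K := ℝ) (V := Fin n → ℂ)).symm
  let e := LinearEquiv.ofInjectiveOfFinrankEq
    ((realForm c : (Fin n → ℂ) →L[ℝ] (Fin n → ℂ) →L[ℝ] ℝ) :
      (Fin n → ℂ) →ₗ[ℝ] ((Fin n → ℂ) →L[ℝ] ℝ)) hinj hdim
  exact ⟨e.toContinuousLinearEquiv, by ext u w; rfl⟩

/-- The values of the Hermitian metric on the line through `z`, as a function of the square of the
parameter: here `p = ⟨u, w⟩`, `r = z·u`, `r' = z·w`, `s = ⟨u, z⟩`, `s' = ⟨z, w⟩`, `ν = |z|²`,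
`q = z·z`. -/
def lineForm (p r r' s s' ν q : ℂ) (t : ℝ) : ℂ :=
  (p + t * (r * star r' / 2)) / (2 + t * ν + t ^ 2 * (q * star q / 8))
    - t * (s + t * (r * star q / 4)) * (s' + t * (q * star r' / 4))
      / (2 + t * ν + t ^ 2 * (q * star q / 8)) ^ 2

/-- The mixed products of `param` with `paramDeriv` are `t` times functions of `t²`. They enter only
through their product, so everything depends on `t²` alone. -/
theorem fubiniStudy_line (z u w : Fin n → ℂ) (t : ℝ) :
    fubiniStudy (param (t • z)) (paramDeriv (t • z) u) (paramDeriv (t • z) w) =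
      lineForm (u ⬝ᵥ star w) (z ⬝ᵥ u) (z ⬝ᵥ w) (u ⬝ᵥ star z) (z ⬝ᵥ star w) (z ⬝ᵥ star z) (z ⬝ᵥ z)
        (t ^ 2) := by
  have hI : Complex.I ^ 2 = -1 := Complex.I_sq
  have hs : (t • z : Fin n → ℂ) = (t : ℂ) • z := by funext i; simp
  have e1 : ∀ x y : Fin n → ℂ, ∑ i, x i * star (y i) = x ⬝ᵥ star y := fun x y => rfl
  have hst : star ((t : ℂ)) = t := Complex.conj_ofReal t
  have hN : param ((t : ℂ) • z) ⬝ᵥ star (param ((t : ℂ) • z)) =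
      2 + ((t ^ 2 : ℝ) : ℂ) * (z ⬝ᵥ star z) + ((t ^ 2 : ℝ) : ℂ) ^ 2 * ((z ⬝ᵥ z) * star (z ⬝ᵥ z) / 8) := by
    rw [sum_dotProduct]
    simp only [param, Pi.star_apply, Sum.elim_inl, Sum.elim_inr, Matrix.cons_val_zero,
      Matrix.cons_val_one, e1, star_smul, smul_dotProduct, dotProduct_smul, smul_eq_mul, hst]
    simp
    linear_combination (-(1 + t * (t * (z ⬝ᵥ z)) / 4)
      * (1 + t * (t * (starRingEnd ℂ) (z ⬝ᵥ z)) / 4)) * hI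
  have hab : paramDeriv ((t : ℂ) • z) u ⬝ᵥ star (paramDeriv ((t : ℂ) • z) w) =
      u ⬝ᵥ star w + ((t ^ 2 : ℝ) : ℂ) * ((z ⬝ᵥ u) * star (z ⬝ᵥ w) / 2) := by
    rw [sum_dotProduct]
    simp only [paramDeriv_apply, Pi.star_apply, Sum.elim_inl, Sum.elim_inr, Matrix.cons_val_zero,
      Matrix.cons_val_one, e1, smul_dotProduct, smul_eq_mul]
    simp
    linear_combination (-(t * (z ⬝ᵥ u)) * (t * (starRingEnd ℂ) (z ⬝ᵥ w)) / 4) * hI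
  have hav : paramDeriv ((t : ℂ) • z) u ⬝ᵥ star (param ((t : ℂ) • z)) =
      t * (u ⬝ᵥ star z + ((t ^ 2 : ℝ) : ℂ) * ((z ⬝ᵥ u) * star (z ⬝ᵥ z) / 4)) := by
    rw [sum_dotProduct]
    simp only [param, paramDeriv_apply, Pi.star_apply, Sum.elim_inl, Sum.elim_inr,
      Matrix.cons_val_zero,
      Matrix.cons_val_one, e1, star_smul, smul_dotProduct, dotProduct_smul, smul_eq_mul, hst]
    simp
    linear_combination (-(t * (z ⬝ᵥ u)) / 2 * (1 + t * (t * (starRingEnd ℂ) (z ⬝ᵥ z)) / 4)) * hI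
  have hvb : param ((t : ℂ) • z) ⬝ᵥ star (paramDeriv ((t : ℂ) • z) w) =
      t * (z ⬝ᵥ star w + ((t ^ 2 : ℝ) : ℂ) * ((z ⬝ᵥ z) * star (z ⬝ᵥ w) / 4)) := by
    rw [sum_dotProduct]
    simp only [param, paramDeriv_apply, Pi.star_apply, Sum.elim_inl, Sum.elim_inr,
      Matrix.cons_val_zero,
      Matrix.cons_val_one, e1, smul_dotProduct, dotProduct_smul, smul_eq_mul]
    simp
    linear_combination (-(t * (starRingEnd ℂ) (z ⬝ᵥ w)) / 2 * (1 + t * (t * (z ⬝ᵥ z)) / 4)) * hI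
  rw [hs, fubiniStudy, hN, hab, hav, hvb, lineForm]
  push_cast
  ring

theorem contDiffAt_lineForm (p r r' s s' ν q : ℂ) :
    ContDiffAt ℝ 2 (lineForm p r r' s s' ν q) 0 := by
  have ht : ContDiffAt ℝ 2 (fun t : ℝ => (t : ℂ)) 0 := Complex.ofRealCLM.contDiff.contDiffAt
  have hN : ContDiffAt ℝ 2 (fun t : ℝ => 2 + t * ν + t ^ 2 * (q * star q / 8)) 0 :=
    (contDiffAt_const.add (ht.mul contDiffAt_const)).add ((ht.pow 2).mul contDiffAt_const)
  unfold lineForm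
  have hdiv : ∀ {f g : ℝ → ℂ}, ContDiffAt ℝ 2 f 0 → ContDiffAt ℝ 2 g 0 → g 0 ≠ 0 →
      ContDiffAt ℝ 2 (fun t => f t / g t) 0 := fun hf hg h => by
    simp only [div_eq_mul_inv]
    exact hf.mul (hg.inv h)
  refine ContDiffAt.sub (hdiv (contDiffAt_const.add (ht.mul contDiffAt_const)) hN (by simp))
    (hdiv ?_ (hN.pow 2) (by simp))
  exact (ht.mul (contDiffAt_const.add (ht.mul contDiffAt_const))).mul
    (contDiffAt_const.add (ht.mul contDiffAt_const))

theorem hasDerivAt_lineForm (p r r' s s' ν q : ℂ) :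
    HasDerivAt (lineForm p r r' s s' ν q) ((r * star r' - p * ν - s * s') / 4) 0 := by
  have ht : HasDerivAt (fun t : ℝ => (t : ℂ)) 1 0 := Complex.ofRealCLM.hasDerivAt
  have hN : HasDerivAt (fun t : ℝ => 2 + (t : ℂ) * ν + (t : ℂ) ^ 2 * (q * star q / 8)) ν 0 := by
    refine (((ht.mul_const ν).const_add 2).add ((ht.pow 2).mul_const _)).congr_deriv ?_
    simp
  have h1 := ((ht.mul_const (r * star r' / 2)).const_add p).div hN (by simp)
  have h2 := ((ht.mul ((ht.mul_const (r * star q / 4)).const_add s)).mul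
    ((ht.mul_const (q * star r' / 4)).const_add s')).div (hN.pow 2) (by simp)
  refine (h1.sub h2).congr_deriv ?_
  simp
  ring

theorem fderiv_affineMetric_line (c : ℝ) (z u w : Fin n → ℂ) :
    fderiv ℝ (affineMetric c) 0 z u w = 0 ∧
    fderiv ℝ (fderiv ℝ (affineMetric c)) 0 z z u w =
      2 * c * ((z ⬝ᵥ u) * star (z ⬝ᵥ w) - (u ⬝ᵥ star w) * (z ⬝ᵥ star z)
        - (u ⬝ᵥ star z) * (z ⬝ᵥ star w)).re := by
  have hG : ContDiff ℝ 2 (affineMetric c : (Fin n → ℂ) → _) :=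
    contDiff_infty.1 (contDiff_affineMetric c) 2
  have hc := contDiffAt_lineForm (u ⬝ᵥ star w) (z ⬝ᵥ u) (z ⬝ᵥ w) (u ⬝ᵥ star z) (z ⬝ᵥ star w)
    (z ⬝ᵥ star z) (z ⬝ᵥ z)
  have hd := hasDerivAt_lineForm (u ⬝ᵥ star w) (z ⬝ᵥ u) (z ⬝ᵥ w) (u ⬝ᵥ star z) (z ⬝ᵥ star w)
    (z ⬝ᵥ star z) (z ⬝ᵥ z)
  have hc' := (contDiffAt_const (c := 4 * c)).mul
    (Complex.reCLM.contDiff.contDiffAt.comp (0 : ℝ) hc)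
  have hd' := (Complex.reCLM.hasFDerivAt.comp_hasDerivAt (0 : ℝ) hd).const_mul (4 * c)
  obtain ⟨h1, h2⟩ := fderiv_fderiv_of_even_line hG hc' hd' fun t => by
    rw [affineMetric_apply, fubiniStudy_line]; rfl
  refine ⟨h1, h2.trans ?_⟩
  rw [Complex.reCLM_apply, show ((4 : ℂ)) = ((4 : ℝ) : ℂ) by norm_num, Complex.div_ofReal_re]
  ring

theorem fderiv_affineMetric_zero (c : ℝ) : fderiv ℝ (affineMetric c) (0 : Fin n → ℂ) = 0 := by
  ext z u w
  simpa using (fderiv_affineMetric_line c z u w).1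

/-- Polarization of the values on the lines through `a`, `b` and `a + b`. -/
theorem fderiv_fderiv_affineMetric_zero (c : ℝ) (a b u w : Fin n → ℂ) :
    fderiv ℝ (fderiv ℝ (affineMetric c)) 0 a b u w =
      c * ((a ⬝ᵥ u) * star (b ⬝ᵥ w) + (b ⬝ᵥ u) * star (a ⬝ᵥ w)
        - (u ⬝ᵥ star w) * (a ⬝ᵥ star b + b ⬝ᵥ star a)
        - (u ⬝ᵥ star a) * (b ⬝ᵥ star w) - (u ⬝ᵥ star b) * (a ⬝ᵥ star w)).re := by
  have hG : ContDiffAt ℝ 2 (affineMetric c) (0 : Fin n → ℂ) :=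
    (contDiff_infty.1 (contDiff_affineMetric c) 2).contDiffAt
  have hs : fderiv ℝ (fderiv ℝ (affineMetric c)) 0 b a =
      fderiv ℝ (fderiv ℝ (affineMetric c)) 0 a b :=
    (hG.isSymmSndFDerivAt (by simp)).eq b a
  have h1 := (fderiv_affineMetric_line c (a + b) u w).2
  have h2 := (fderiv_affineMetric_line c a u w).2
  have h3 := (fderiv_affineMetric_line c b u w).2
  simp only [map_add, _root_.add_apply, hs, h2, h3] at h1
  simp only [star_add, add_dotProduct, dotProduct_add] at h1
  simp only [Complex.sub_re, Complex.add_re, mul_add, add_mul] at h1 ⊢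
  linarith

/-- The Hermitian operator `w ↦ |u|² w + ⟨w, u⟩ u - (w·u) ū` of `ℂ^n`. -/
def curvOp (u : Fin n → ℂ) : (Fin n → ℂ) →ₗ[ℂ] (Fin n → ℂ) where
  toFun w := (u ⬝ᵥ star u) • w + (w ⬝ᵥ star u) • u - (w ⬝ᵥ u) • star u
  map_add' w w' := by simp only [add_dotProduct, add_smul, smul_add]; abel
  map_smul' r w := by
    simp only [smul_dotProduct, smul_eq_mul, mul_smul, smul_sub, smul_add, RingHom.id_apply,
      smul_comm r]

theorem curvOp_apply (u w : Fin n → ℂ) :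
    curvOp u w = (u ⬝ᵥ star u) • w + (w ⬝ᵥ star u) • u - (w ⬝ᵥ u) • star u := rfl

theorem curvOp_dotProduct_star (u w y : Fin n → ℂ) :
    curvOp u w ⬝ᵥ star y = (u ⬝ᵥ star u) * (w ⬝ᵥ star y) + (w ⬝ᵥ star u) * (u ⬝ᵥ star y)
      - (w ⬝ᵥ u) * star (y ⬝ᵥ u) := by
  rw [curvOp_apply, sub_dotProduct, add_dotProduct, smul_dotProduct, smul_dotProduct,
    smul_dotProduct, show star u ⬝ᵥ star y = star (y ⬝ᵥ u) by rw [Matrix.star_dotProduct_star]]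
  rfl

/-- Only pairs `(u, iu)` are needed, because `R(U, Ū)` with `U = u - iJu` involves no other values
of `R`. Nondegeneracy of the metric reduces the claim to an identity of inner products with `y`. -/
theorem curvature_affineMetric {c : ℝ} (hc : 0 < c) (u w : Fin n → ℂ) :
    curvature (affineMetric c) 0 u (Complex.I • u) w = -(Complex.I • curvOp u w) := by
  have hG : ContDiffAt ℝ 2 (affineMetric c) (0 : Fin n → ℂ) :=
    (contDiff_infty.1 (contDiff_affineMetric c) 2).contDiffAt
  have hinv := realForm_isInvertible (n := n) hc
  rw [← affineMetric_zero] at hinv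
  have hinj : Function.Injective (affineMetric c (0 : Fin n → ℂ)) := by
    obtain ⟨e, he⟩ := hinv
    rw [← he]
    exact e.injective
  apply hinj
  ext y
  have h := curvature_of_fderiv_eq_zero hG (fderiv_affineMetric_zero c) hinv u (Complex.I • u) w y
  have h2 : 2 * affineMetric c 0 (-(Complex.I • curvOp u w)) y =
      4 * c * (-(Complex.I * (curvOp u w ⬝ᵥ star y))).re := by
    rw [affineMetric_zero, realForm_apply, neg_dotProduct, smul_dotProduct, smul_eq_mul]
    ring
  suffices 2 * affineMetric c 0 (curvature (affineMetric c) 0 u (Complex.I • u) w) y =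
      2 * affineMetric c 0 (-(Complex.I • curvOp u w)) y by linarith
  rw [h, h2, curvOp_dotProduct_star]
  simp only [fderiv_fderiv_affineMetric_zero, smul_dotProduct, dotProduct_smul, star_smul,
    smul_eq_mul, star_mul]
  rw [dotProduct_star_comm u w, dotProduct_star_comm u y, dotProduct_star_comm w y,
    dotProduct_comm w u, dotProduct_comm y u, dotProduct_comm y w]
  -- With `|u|²` known to be real and all products put in a fixed order, the claim is a polynomial
  -- identity in the real and imaginary parts of seven independent numbers.
  have hν : u ⬝ᵥ star u = ((∑ i, Complex.normSq (u i) : ℝ) : ℂ) := dotProduct_star_self u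
  rw [hν]
  generalize (∑ i, Complex.normSq (u i) : ℝ) = ν
  generalize u ⬝ᵥ star w = p1
  generalize u ⬝ᵥ star y = p2
  generalize w ⬝ᵥ star y = p3
  generalize u ⬝ᵥ w = p4
  generalize u ⬝ᵥ y = p5
  generalize w ⬝ᵥ y = p6
  generalize u ⬝ᵥ u = p7
  simp
  ring

end

end Hyperquadric

/-! ## Holomorphic tangent vectors and the spectrum of the curvature operator -/

namespace Hyperquadric

noncomputable section

open RiemannianChart Bisectional

variable {n : ℕ}

/-- Multiplication by `√-1` on `ℂ^n`, as a real endomorphism. -/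
def mulI (n : ℕ) : Module.End ℝ (Fin n → ℂ) :=
  (Complex.I • (LinearMap.id : (Fin n → ℂ) →ₗ[ℂ] (Fin n → ℂ))).restrictScalars ℝ

theorem mulI_apply (u : Fin n → ℂ) : mulI n u = Complex.I • u := rfl

/-- The map `u ↦ u - √-1 J u` of `ℂ^n` to its complexification. -/
def toHolomorphic : (Fin n → ℂ) →ₗ[ℂ] ℂ ⊗[ℝ] (Fin n → ℂ) where
  toFun u := 1 ⊗ₜ[ℝ] u - Complex.I ⊗ₜ[ℝ] (Complex.I • u)
  map_add' u w := by simp only [smul_add, TensorProduct.tmul_add]; abel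
  map_smul' r u := by
    have h : ∀ (a : ℂ) (v : Fin n → ℂ), a ⊗ₜ[ℝ] (r • v) =
        (r.re * a) ⊗ₜ[ℝ] v + (r.im * a) ⊗ₜ[ℝ] (Complex.I • v) := fun a v => by
      have hr : r • v = r.re • v + r.im • (Complex.I • v) := by
        funext i
        simp only [Pi.smul_apply, Pi.add_apply, smul_eq_mul, Complex.real_smul]
        conv_lhs => rw [← Complex.re_add_im r]
        ring
      rw [hr, TensorProduct.tmul_add, TensorProduct.tmul_smul, TensorProduct.tmul_smul,
        TensorProduct.smul_tmul', TensorProduct.smul_tmul', Complex.real_smul, Complex.real_smul]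
    have hI : Complex.I • Complex.I • u = -u := by
      rw [smul_smul, Complex.I_mul_I, neg_one_smul]
    rw [smul_comm Complex.I r u, h, h, hI, TensorProduct.tmul_neg, RingHom.id_apply, smul_sub]
    simp only [TensorProduct.smul_tmul', smul_eq_mul]
    have h1 : r * 1 = r.re * 1 + r.im * Complex.I := by
      rw [mul_one, mul_one, Complex.re_add_im]
    have h2 : r * Complex.I = r.re * Complex.I - r.im * 1 := by
      conv_lhs => rw [← Complex.re_add_im r]
      linear_combination (r.im : ℂ) * Complex.I_mul_I
    rw [h1, h2, TensorProduct.add_tmul, TensorProduct.sub_tmul]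
    abel

theorem toHolomorphic_apply (u : Fin n → ℂ) :
    toHolomorphic u = 1 ⊗ₜ[ℝ] u - Complex.I ⊗ₜ[ℝ] (Complex.I • u) := rfl

theorem toHolomorphic_mem (u : Fin n → ℂ) : toHolomorphic u ∈ holomorphicPart (mulI n) := by
  have hI : Complex.I • Complex.I • u = -u := by
    rw [smul_smul, Complex.I_mul_I, neg_one_smul]
  rw [holomorphicPart, Module.End.mem_eigenspace_iff, toHolomorphic_apply, map_sub,
    LinearMap.baseChange_tmul, LinearMap.baseChange_tmul, mulI_apply, mulI_apply, hI, smul_sub,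
    TensorProduct.tmul_neg]
  simp only [TensorProduct.smul_tmul', smul_eq_mul, mul_one, Complex.I_mul_I,
    TensorProduct.neg_tmul]
  abel

/-- The operator `1 - iJ` is twice the projection onto the holomorphic part; on the `i`-eigenspace
it is multiplication by `2`, whence the surjectivity in `holomorphicEquiv`. -/
theorem sub_baseChange_mem_range (U : ℂ ⊗[ℝ] (Fin n → ℂ)) :
    U - Complex.I • (mulI n).baseChange ℂ U ∈ LinearMap.range toHolomorphic := by
  induction U using TensorProduct.induction_on with
  | zero => simp
  | tmul a u =>
    refine ⟨a • u, ?_⟩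
    rw [map_smul, toHolomorphic_apply, LinearMap.baseChange_tmul, mulI_apply, smul_sub,
      TensorProduct.smul_tmul', TensorProduct.smul_tmul', TensorProduct.smul_tmul']
    simp [mul_comm]
  | add U V hU hV =>
    have := add_mem hU hV
    rwa [sub_add_sub_comm, ← smul_add, ← map_add] at this

theorem toHolomorphic_injective : Function.Injective (toHolomorphic (n := n)) := by
  refine (injective_iff_map_eq_zero _).2 fun u hu => ?_
  -- The multiplication map `a ⊗ v ↦ a v` sends `u - iJu` to `u - i(iu) = 2u`.
  have h := congrArg (LinearMap.liftBaseChange ℂ (LinearMap.id : (Fin n → ℂ) →ₗ[ℝ] (Fin n → ℂ))) hu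
  rw [toHolomorphic_apply, map_sub, LinearMap.liftBaseChange_tmul, LinearMap.liftBaseChange_tmul,
    map_zero] at h
  funext i
  have h2 := congrFun h i
  simpa [← mul_assoc] using h2

/-- The complex linear isomorphism of `ℂ^n` with its holomorphic part. -/
def holomorphicEquiv (n : ℕ) : (Fin n → ℂ) ≃ₗ[ℂ] holomorphicPart (mulI n) :=
  LinearEquiv.ofBijective (toHolomorphic.codRestrict _ toHolomorphic_mem) <| by
    refine ⟨fun u w h => toHolomorphic_injective (congrArg Subtype.val h), ?_⟩
    rintro ⟨U, hU⟩
    obtain ⟨u, hu⟩ := sub_baseChange_mem_range U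
    have h1 : (mulI n).baseChange ℂ U = Complex.I • U := Module.End.mem_eigenspace_iff.1 hU
    rw [h1, smul_smul, Complex.I_mul_I, neg_one_smul, sub_neg_eq_add, ← two_smul ℂ U] at hu
    refine ⟨(2 : ℂ)⁻¹ • u, Subtype.ext ?_⟩
    change toHolomorphic ((2 : ℂ)⁻¹ • u) = U
    rw [map_smul, hu, smul_smul, inv_mul_cancel₀ two_ne_zero, one_smul]

theorem coe_holomorphicEquiv (u : Fin n → ℂ) :
    (holomorphicEquiv n u : ℂ ⊗[ℝ] (Fin n → ℂ)) = toHolomorphic u := rfl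

theorem exists_toHolomorphic_eq {U : ℂ ⊗[ℝ] (Fin n → ℂ)} (hU : U ∈ holomorphicPart (mulI n)) :
    ∃ u, toHolomorphic u = U := by
  obtain ⟨u, hu⟩ := (holomorphicEquiv n).surjective ⟨U, hU⟩
  exact ⟨u, congrArg Subtype.val hu⟩

theorem conj_toHolomorphic (u : Fin n → ℂ) :
    conj (toHolomorphic u) = 1 ⊗ₜ[ℝ] u + Complex.I ⊗ₜ[ℝ] (Complex.I • u) := by
  simp [toHolomorphic_apply, conj, LinearMap.rTensor_tmul, TensorProduct.neg_tmul]

/-- Antisymmetry gives `R(u - iJu, u + iJu) = 2i R(u, Ju)`, and on the holomorphic part `-i A_u`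
composed with `2i` is `2 A_u`. -/
theorem curvatureOperator_toHolomorphic
    (R : (Fin n → ℂ) →ₗ[ℝ] (Fin n → ℂ) →ₗ[ℝ] Module.End ℝ (Fin n → ℂ))
    (h0 : ∀ u w, R u u w = 0) (h1 : ∀ u v w, R u v w = -R v u w)
    (hR : ∀ u w, R u (Complex.I • u) w = -(Complex.I • curvOp u w)) (u w : Fin n → ℂ) :
    curvatureOperator R (toHolomorphic u) (toHolomorphic w) =
      (2 : ℂ) • toHolomorphic (curvOp u w) := by
  have hR' : ∀ w, R (Complex.I • u) u w = Complex.I • curvOp u w := fun w => by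
    rw [h1, hR, neg_neg]
  have hI : ∀ v : Fin n → ℂ, Complex.I • Complex.I • v = -v := fun v => by
    rw [smul_smul, Complex.I_mul_I, neg_one_smul]
  rw [curvatureOperator, conj_toHolomorphic, toHolomorphic_apply u, toHolomorphic_apply w,
    toHolomorphic_apply (curvOp u w)]
  simp only [map_sub, map_add, LinearMap.sub_apply, LinearMap.add_apply, complexCurvature_tmul,
    h0, hR, hR', map_smul (curvOp u), hI, TensorProduct.tmul_zero, TensorProduct.tmul_neg,
    mul_one, one_mul, Complex.I_mul_I, TensorProduct.neg_tmul, neg_mul]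
  rw [two_smul]
  abel

theorem bisectionalCurvature_toHolomorphic {c : ℝ} (g : LinearMap.BilinForm ℝ (Fin n → ℂ))
    (hg : ∀ u w, g u w = 2 * c * (u ⬝ᵥ star w).re)
    (R : (Fin n → ℂ) →ₗ[ℝ] (Fin n → ℂ) →ₗ[ℝ] Module.End ℝ (Fin n → ℂ))
    (h0 : ∀ u w, R u u w = 0) (h1 : ∀ u v w, R u v w = -R v u w)
    (hR : ∀ u w, R u (Complex.I • u) w = -(Complex.I • curvOp u w)) (u w : Fin n → ℂ) :
    bisectionalCurvature g R (toHolomorphic u) (toHolomorphic w) =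
      8 * c * (curvOp u w ⬝ᵥ star w) := by
  rw [bisectionalCurvature, curvatureOperator_toHolomorphic R h0 h1 hR, conj_toHolomorphic,
    toHolomorphic_apply]
  simp only [map_smul, map_sub, map_add, LinearMap.smul_apply, LinearMap.sub_apply,
    LinearMap.BilinForm.baseChange_tmul, hg]
  simp only [smul_dotProduct, dotProduct_smul, star_smul]
  generalize curvOp u w ⬝ᵥ star w = s
  apply Complex.ext <;> simp <;> ring

/-! ### Positivity and spectrum of the Hermitian operator -/

theorem curvOp_dotProduct_star_self (u w : Fin n → ℂ) :
    curvOp u w ⬝ᵥ star w = (((∑ i, Complex.normSq (u i)) * (∑ i, Complex.normSq (w i))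
      + Complex.normSq (w ⬝ᵥ star u) - Complex.normSq (w ⬝ᵥ u) : ℝ) : ℂ) := by
  rw [curvOp_dotProduct_star, dotProduct_star_self, dotProduct_star_self, dotProduct_star_comm w u]
  push_cast
  rw [← Complex.mul_conj, ← Complex.mul_conj]
  rfl

theorem norm_toLp_sq (u : Fin n → ℂ) :
    ‖(WithLp.toLp 2 u : EuclideanSpace ℂ (Fin n))‖ ^ 2 = ∑ i, Complex.normSq (u i) := by
  simp [EuclideanSpace.norm_sq_eq, Complex.normSq_eq_norm_sq]

theorem inner_toLp (u w : Fin n → ℂ) :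
    inner ℂ (WithLp.toLp 2 u : EuclideanSpace ℂ (Fin n)) (WithLp.toLp 2 w) = w ⬝ᵥ star u := rfl

/-- Cauchy–Schwarz for `w` and `ū`, since `w·u = ⟨w, ū⟩`. -/
theorem normSq_dotProduct_le (u w : Fin n → ℂ) :
    Complex.normSq (w ⬝ᵥ u) ≤ (∑ i, Complex.normSq (u i)) * ∑ i, Complex.normSq (w i) := by
  have h := norm_inner_le_norm (𝕜 := ℂ) (WithLp.toLp 2 (star u) : EuclideanSpace ℂ (Fin n))
    (WithLp.toLp 2 w)
  rw [inner_toLp, star_star] at h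
  have h2 := pow_le_pow_left₀ (norm_nonneg _) h 2
  rw [mul_pow, norm_toLp_sq, norm_toLp_sq, ← Complex.normSq_eq_norm_sq] at h2
  simpa using h2

theorem curvOp_dotProduct_star_self_nonneg (u w : Fin n → ℂ) :
    0 ≤ (curvOp u w ⬝ᵥ star w).re ∧ (curvOp u w ⬝ᵥ star w).im = 0 := by
  rw [curvOp_dotProduct_star_self, Complex.ofReal_re, Complex.ofReal_im]
  have := normSq_dotProduct_le u w
  have := Complex.normSq_nonneg (w ⬝ᵥ star u)
  exact ⟨by linarith, rfl⟩

theorem bisectionalCurvature_nonneg {c : ℝ} (hc : 0 < c) (g : LinearMap.BilinForm ℝ (Fin n → ℂ))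
    (hg : ∀ u w, g u w = 2 * c * (u ⬝ᵥ star w).re)
    (R : (Fin n → ℂ) →ₗ[ℝ] (Fin n → ℂ) →ₗ[ℝ] Module.End ℝ (Fin n → ℂ))
    (h0 : ∀ u w, R u u w = 0) (h1 : ∀ u v w, R u v w = -R v u w)
    (hR : ∀ u w, R u (Complex.I • u) w = -(Complex.I • curvOp u w)) {U W : ℂ ⊗[ℝ] (Fin n → ℂ)}
    (hU : U ∈ holomorphicPart (mulI n)) (hW : W ∈ holomorphicPart (mulI n)) :
    0 ≤ (bisectionalCurvature g R U W).re ∧ (bisectionalCurvature g R U W).im = 0 := by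
  obtain ⟨u, rfl⟩ := exists_toHolomorphic_eq hU
  obtain ⟨w, rfl⟩ := exists_toHolomorphic_eq hW
  obtain ⟨hre, him⟩ := curvOp_dotProduct_star_self_nonneg u w
  have h8 : (8 * c : ℂ) = ((8 * c : ℝ) : ℂ) := by push_cast; rfl
  rw [bisectionalCurvature_toHolomorphic g hg R h0 h1 hR, h8, Complex.re_ofReal_mul,
    Complex.im_ofReal_mul, him, mul_zero]
  exact ⟨by positivity, rfl⟩

/-- The kernel of the curvature operator is contained in the line spanned by `ū`. -/
theorem exists_eq_smul_of_curvOp_eq_zero {u w : Fin n → ℂ} (hu : u ≠ 0) (h : curvOp u w = 0) :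
    ∃ r : ℂ, w = r • star u := by
  have h1 := curvOp_dotProduct_star_self u w
  rw [h, zero_dotProduct] at h1
  have h2 : (∑ i, Complex.normSq (u i)) * (∑ i, Complex.normSq (w i))
      + Complex.normSq (w ⬝ᵥ star u) - Complex.normSq (w ⬝ᵥ u) = 0 := by exact_mod_cast h1.symm
  have h3 := normSq_dotProduct_le u w
  have h4 := Complex.normSq_nonneg (w ⬝ᵥ star u)
  -- The sum in `h2` splits into the Cauchy–Schwarz defect and `|⟨w,u⟩|²`, both nonnegative, so the
  -- latter vanishes.
  have h5 : w ⬝ᵥ star u = 0 := Complex.normSq_eq_zero.1 (by linarith)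
  rw [curvOp_apply, h5, zero_smul, add_zero, sub_eq_zero] at h
  refine ⟨(u ⬝ᵥ star u)⁻¹ * (w ⬝ᵥ u), ?_⟩
  rw [mul_smul, ← h, smul_smul, inv_mul_cancel₀ (dotProduct_star_self_ne_zero hu), one_smul]

/-- The curvature operator on Euclidean space. -/
def euclideanCurvOp (u : Fin n → ℂ) : EuclideanSpace ℂ (Fin n) →ₗ[ℂ] EuclideanSpace ℂ (Fin n) :=
  (WithLp.linearEquiv 2 ℂ (Fin n → ℂ)).symm.toLinearMap ∘ₗ curvOp u ∘ₗ
    (WithLp.linearEquiv 2 ℂ (Fin n → ℂ)).toLinearMap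

theorem euclideanCurvOp_isSymmetric (u : Fin n → ℂ) : (euclideanCurvOp u).IsSymmetric := by
  intro x y
  change y.ofLp ⬝ᵥ star (curvOp u x.ofLp) = curvOp u y.ofLp ⬝ᵥ star x.ofLp
  rw [dotProduct_star_comm (curvOp u x.ofLp) y.ofLp, curvOp_dotProduct_star,
    curvOp_dotProduct_star, dotProduct_star_comm y.ofLp x.ofLp,
    dotProduct_star_comm u y.ofLp, dotProduct_star_comm u x.ofLp, dotProduct_star_self u]
  simp
  ring

theorem exists_eigenvalues_curvOp {u : Fin n → ℂ} (hu : u ≠ 0) :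
    ∃ (ev : Fin n → ℝ) (b : Module.Basis (Fin n) ℂ (Fin n → ℂ)), Monotone ev ∧
      (∀ i, curvOp u (b i) = (ev i : ℂ) • b i) ∧ (∀ i, 0 ≤ ev i) ∧
      ∀ i j, ev i = 0 → ev j = 0 → i = j := by
  have hT := euclideanCurvOp_isSymmetric u
  have hn : Module.finrank ℂ (EuclideanSpace ℂ (Fin n)) = n := finrank_euclideanSpace_fin
  -- The spectral theorem lists eigenvalues in decreasing order; `Fin.rev` makes the list
  -- increasing.
  let b := (((hT.eigenvectorBasis hn).toBasis.map (WithLp.linearEquiv 2 ℂ (Fin n → ℂ))).reindex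
    Fin.revPerm)
  have hb : ∀ i, b i = (hT.eigenvectorBasis hn (Fin.rev i)).ofLp := fun i => by
    simp [b]
  have hev : ∀ i, curvOp u (b i) = (hT.eigenvalues hn (Fin.rev i) : ℂ) • b i := fun i => by
    have := congrArg WithLp.ofLp (hT.apply_eigenvectorBasis hn (Fin.rev i))
    rw [hb]
    exact this
  refine ⟨fun i => hT.eigenvalues hn (Fin.rev i), b, ?_, hev, fun i => ?_, fun i j hi hj => ?_⟩
  · exact fun i j hij => hT.eigenvalues_antitone hn (Fin.rev_le_rev.2 hij)
  -- On a unit eigenvector the quadratic form takes the eigenvalue as its value.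
  · have h1 := (curvOp_dotProduct_star_self_nonneg u (b i)).1
    have h2 : b i ⬝ᵥ star (b i) = 1 := by
      rw [hb, ← inner_toLp]
      exact inner_self_eq_one_of_norm_eq_one ((hT.eigenvectorBasis hn).orthonormal.1 _)
    rw [hev, smul_dotProduct, h2] at h1
    simpa using h1
  · obtain ⟨r, hr⟩ := exists_eq_smul_of_curvOp_eq_zero hu (w := b i) ((hev i).trans (by
      rw [show hT.eigenvalues hn (Fin.rev i) = 0 from hi, Complex.ofReal_zero, zero_smul]))
    obtain ⟨s, hs⟩ := exists_eq_smul_of_curvOp_eq_zero hu (w := b j) ((hev j).trans (by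
      rw [show hT.eigenvalues hn (Fin.rev j) = 0 from hj, Complex.ofReal_zero, zero_smul]))
    -- Two distinct basis vectors would both lie on the line of `ū`, against linear independence.
    by_contra hij
    have hr0 : r ≠ 0 := fun h => b.ne_zero i (by rw [hr, h, zero_smul])
    have hs' : star u = r⁻¹ • b i := by rw [hr, smul_smul, inv_mul_cancel₀ hr0, one_smul]
    have h1 : b j = (s * r⁻¹) • b i := by rw [mul_smul, ← hs', hs]
    have h2 := congrArg (fun v => b.repr v j) h1
    simp [Finsupp.single_eq_of_ne (Ne.symm hij)] at h2

theorem hasOrderedEigenvalues_of_curvOp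
    (R : (Fin n → ℂ) →ₗ[ℝ] (Fin n → ℂ) →ₗ[ℝ] Module.End ℝ (Fin n → ℂ))
    (h0 : ∀ u w, R u u w = 0) (h1 : ∀ u v w, R u v w = -R v u w)
    (hR : ∀ u w, R u (Complex.I • u) w = -(Complex.I • curvOp u w))
    {U : ℂ ⊗[ℝ] (Fin n → ℂ)} (hU : U ∈ holomorphicPart (mulI n)) (hU0 : U ≠ 0) :
    ∃ ev : Fin n → ℝ, HasOrderedEigenvalues (curvatureOperator R U) (holomorphicPart (mulI n)) ev ∧
      (∀ i, 0 ≤ ev i) ∧ ∀ i j, ev i = 0 → ev j = 0 → i = j := by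
  obtain ⟨u, rfl⟩ := exists_toHolomorphic_eq hU
  have hu : u ≠ 0 := fun h => hU0 (by rw [h, map_zero])
  obtain ⟨ev, b, hmono, hev, hnn, hz⟩ := exists_eigenvalues_curvOp hu
  refine ⟨fun i => 2 * ev i, ⟨fun i j hij => ?_, b.map (holomorphicEquiv n), fun i => ?_⟩,
    fun i => mul_nonneg zero_le_two (hnn i), fun i j hi hj => hz i j (by linarith) (by linarith)⟩
  · exact mul_le_mul_of_nonneg_left (hmono hij) zero_le_two
  · rw [Module.Basis.map_apply, coe_holomorphicEquiv,
      curvatureOperator_toHolomorphic R h0 h1 hR, hev, map_smul, smul_smul]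
    push_cast
    rfl

/-- The preferred chart at `x` is centred at `x`, so every point has the curvature tensor of
`affineMetric` at the origin. -/
theorem curvatureAt_standardMetric_apply (c : ℝ) (x : Hyperquadric n) (u v w : Fin n → ℂ) :
    curvatureAt (standardMetric c) x u v w = curvature (affineMetric c) 0 u v w := by
  have h0 : chartAt (Fin n → ℂ) x x = 0 := chart_frame_self x
  change curvature (metricInChart (standardMetric c) x) (chartAt (Fin n → ℂ) x x) u v w = _
  rw [metricInChart_standardMetric, h0]

end

end Hyperquadric

theorem corollary2p3 (n : ℕ) (hn : 1 ≤ n) (c : ℝ) (hc : 0 < c) :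
    (∃ g : RiemannianChart.MetricField (Fin n → ℂ) (Hyperquadric n),
      Hyperquadric.IsHermitianSymmetricMetric c g) ∧
    ∀ g : RiemannianChart.MetricField (Fin n → ℂ) (Hyperquadric n),
      Hyperquadric.IsHermitianSymmetricMetric c g →
        Bisectional.HasNonnegBisectionalCurvature g Hyperquadric.complexStructure ∧
        (∀ x : Hyperquadric n,
          ∀ U ∈ Bisectional.holomorphicPart (Hyperquadric.complexStructure x), U ≠ 0 →
            ∃ ev : Fin n → ℝ,
              Bisectional.HasOrderedEigenvalues
                (Bisectional.curvatureOperator (RiemannianChart.curvatureAt g x) U)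
                (Bisectional.holomorphicPart (Hyperquadric.complexStructure x)) ev ∧
              (∀ i, 0 ≤ ev i) ∧ ∀ i j, ev i = 0 → ev j = 0 → i = j) ∧
        ∀ h2 : 2 ≤ n,
          Bisectional.HasTwoPositiveBisectionalCurvature g Hyperquadric.complexStructure n h2 := by
  refine ⟨⟨_, Hyperquadric.isHermitianSymmetricMetric_standardMetric hc⟩, fun g hg => ?_⟩
  rw [hg.eq_standardMetric hn]
  have h0 : ∀ (x : Hyperquadric n) (u w : Fin n → ℂ),
      RiemannianChart.curvatureAt (Hyperquadric.standardMetric c) x u u w = 0 := fun x u w =>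
    (Hyperquadric.curvatureAt_standardMetric_apply c x u u w).trans
      (RiemannianChart.curvature_self (Hyperquadric.affineMetric c) 0 u w)
  have h1 : ∀ (x : Hyperquadric n) (u v w : Fin n → ℂ),
      RiemannianChart.curvatureAt (Hyperquadric.standardMetric c) x u v w =
        -RiemannianChart.curvatureAt (Hyperquadric.standardMetric c) x v u w := fun x u v w =>
    (Hyperquadric.curvatureAt_standardMetric_apply c x u v w).trans
      ((RiemannianChart.curvature_antisymm (Hyperquadric.affineMetric c) 0 u v w).trans
        (congrArg Neg.neg (Hyperquadric.curvatureAt_standardMetric_apply c x v u w).symm))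
  have hR : ∀ (x : Hyperquadric n) (u w : Fin n → ℂ),
      RiemannianChart.curvatureAt (Hyperquadric.standardMetric c) x u (Complex.I • u) w =
        -(Complex.I • Hyperquadric.curvOp u w) := fun x u w =>
    (Hyperquadric.curvatureAt_standardMetric_apply c x u _ w).trans
      (Hyperquadric.curvature_affineMetric hc u w)
  have hev : ∀ x : Hyperquadric n,
      ∀ U ∈ Bisectional.holomorphicPart (Hyperquadric.complexStructure x), U ≠ 0 →
        ∃ ev : Fin n → ℝ,
          Bisectional.HasOrderedEigenvalues
            (Bisectional.curvatureOperator
              (RiemannianChart.curvatureAt (Hyperquadric.standardMetric c) x) U)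
            (Bisectional.holomorphicPart (Hyperquadric.complexStructure x)) ev ∧
          (∀ i, 0 ≤ ev i) ∧ ∀ i j, ev i = 0 → ev j = 0 → i = j := fun x U hU hU0 =>
    Hyperquadric.hasOrderedEigenvalues_of_curvOp
      (RiemannianChart.curvatureAt (Hyperquadric.standardMetric c) x) (h0 x) (h1 x) (hR x) hU hU0
  refine ⟨fun x U hU W hW => ?_, hev, fun h2 x U hU hU0 => ?_⟩
  · exact Hyperquadric.bisectionalCurvature_nonneg hc
      (Bisectional.metricForm (Hyperquadric.standardMetric c) x)
      (Hyperquadric.standardMetric_apply c x)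
      (RiemannianChart.curvatureAt (Hyperquadric.standardMetric c) x) (h0 x) (h1 x) (hR x) hU hW
  · obtain ⟨ev, hord, hnn, hz⟩ := hev x U hU hU0
    refine ⟨ev, hord, ?_⟩
    -- If the sum of the first two eigenvalues were zero, both would vanish, although at most one
    -- can.
    refine lt_of_le_of_ne (add_nonneg (hnn _) (hnn _)) fun h => ?_
    have ha := hnn ⟨0, by omega⟩
    have hb := hnn ⟨1, by omega⟩
    have := hz ⟨0, by omega⟩ ⟨1, by omega⟩ (by linarith) (by linarith)
    simp at this
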